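/- Let $(M,g)$ be a Riemannian manifold of dimension $n\ge 4$ with Ricci tensor $r$, scalar curvature $s$, traceless Ricci tensor $z=r-\frac sn g$ and Riemann tensor $R$, where $R(X,Y,X,Y)$ is the sectional curvature for orthonormal $X,Y$. The Weyl tensor $\mathcal W$ is defined by $R=\frac{s}{2n(n-1)}\,g\owedge g+\frac1{n-2}\,z\owedge g+\mathcal W$ (with $\owedge$ the Kulkarni--Nomizu product), and the Bach tensor by $$B(X,Y)=\frac1{n-3}\sum_{i,j}D_{E_i}D_{E_j}\mathcal W(X,E_i,Y,E_j)+\frac1{n-2}\sum_{i,j}\mathcal W(X,E_i,Y,E_j)\,r(E_i,E_j),$$ where $\{E_i\}$ is an orthonormal frame and $D$ denotes covariant differentiation. Put $$\mathrm{div}^2B=\sum_{i,j}D_{E_j}D_{E_i}B(E_i,E_j),\qquad \mathrm{div}^4\mathcal W=\sum_{i,j,k,l}D_{E_j}D_{E_l}D_{E_k}D_{E_i}\mathcal W(E_i,E_j,E_k,E_l).$$ A complete Riemannian manifold $(M^n,g)$ is called a vacuum static space if there is a smooth function $f\not\equiv0$ on $M$ with $$\Delta f=-\frac{s}{n-1}f,\qquad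 D\,df-\Big(r-\frac{s}{n-1}g\Big)f=0 .$$ Proposition. For every $n\ge4$ there is a connected $n$-dimensional vacuum static space with $\mathrm{div}^2B=0$ and $\mathrm{div}^4\mathcal W=0$ but $B\ne0$. More precisely, writing $S^m(c)$ for the round $m$-sphere of constant sectional curvature $c>0$, the following Riemannian products have these properties: (a) in dimension $2m$, $m\ge2$: $S^m\big(\tfrac{a}{kl}\big)\times S^m\big(\tfrac{a}{l}\big)$ for every $a>0$, where $k=\frac{m}{m-1}$ and $l=\frac{3m(m-1)}{2}$; (b) in dimension $2m+1$, $m\ge2$: the product $S^m\times S^{m+1}$ of unit spheres. -/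

import Mathlib

open scoped Manifold ContDiff Bundle

noncomputable section

namespace StaticSpace

/-! ### Tensor calculus of a metric on an open piece of a vector space

`G` is a field of symmetric positive definite bilinear forms on (an open subset of) the finite
dimensional vector space `E`. A covariant `k`-tensor field is `T : E → (Fin k → E) → ℝ`, where
`T x ![v₁, …, vₖ]` is the value at the point `x` on the (constant) vectors `v₁, …, vₖ`. -/

section Local

variable {E : Type*} [NormedAddCommGroup E] [NormedSpace ℝ E]

/-- A field of bilinear forms on `E`. -/
abbrev BilinField (E : Type*) [NormedAddCommGroup E] [NormedSpace ℝ E] :=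
  E → E →L[ℝ] E →L[ℝ] ℝ

/-- A covariant `k`-tensor field on `E`. -/
abbrev TensorField (E : Type*) (k : ℕ) := E → (Fin k → E) → ℝ

/-- The Christoffel symbols `Γ(u, v)` of the Levi-Civita connection: the vector with
`2 G(Γ(u, v), w) = ∂ᵤG(v, w) + ∂ᵥG(u, w) - ∂_wG(u, v)` for all `w`. -/
def christoffel (G : BilinField E) (x u v : E) : E :=
  (G x).inverse ((1 / 2 : ℝ) •
    (fderiv ℝ G x u v + fderiv ℝ G x v u - ((fderiv ℝ G x).flip u).flip v))

/-- The covariant derivative: `(DT)(u, v₁, …, vₖ) = (D_u T)(v₁, …, vₖ)`. The direction of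
differentiation is the first argument. -/
def covDeriv (G : BilinField E) {k : ℕ} (T : TensorField E k) : TensorField E (k + 1) :=
  fun x w =>
    fderiv ℝ (fun y => T y (Fin.tail w)) x (w 0)
      - ∑ i : Fin k,
          T x (Function.update (Fin.tail w) i (christoffel G x (w 0) (Fin.tail w i)))

/-- The trace with respect to `G x` of a bilinear form `b`, i.e. `∑ᵢⱼ Gⁱʲ b(eᵢ, eⱼ)` for a basis
`e` of `E` (the value does not depend on the basis; for a `G x`-orthonormal basis it is
`∑ᵢ b(eᵢ, eᵢ)`). The vector `(G x).inverse (eⁱ)` is `∑ⱼ Gⁱʲ eⱼ`, with `eⁱ` the dual basis. -/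
def metricTrace [FiniteDimensional ℝ E] (G : BilinField E) (x : E) (b : E → E → ℝ) : ℝ :=
  ∑ i, b (Module.finBasis ℝ E i)
    ((G x).inverse (LinearMap.toContinuousLinearMap ((Module.finBasis ℝ E).coord i)))

/-- The divergence of a tensor field in the slot `j` (slots are numbered from `0`):
`(div_j T)(v) = ∑ᵢ (D_{Eᵢ} T)(v₀, …, Eᵢ, …)`, with `Eᵢ` inserted in the slot `j` and `{Eᵢ}` an
orthonormal frame. -/
def divSlot [FiniteDimensional ℝ E] (G : BilinField E) {k : ℕ} (j : Fin (k + 1))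
    (T : TensorField E (k + 1)) : TensorField E k :=
  fun x v => metricTrace G x fun a b => covDeriv G T x (Fin.cons a (Fin.insertNth j b v))

/-- The curvature operator `R(u, v)w = D_u D_v w - D_v D_u w - D_{[u, v]} w`. -/
def curvOp (G : BilinField E) (x u v w : E) : E :=
  fderiv ℝ (fun y => christoffel G y v w) x u - fderiv ℝ (fun y => christoffel G y u w) x v
    + christoffel G x u (christoffel G x v w) - christoffel G x v (christoffel G x u w)

/-- The Riemann curvature tensor, with the sign for which `Rm(u, v, u, v)` is the sectional
curvature of the plane spanned by orthonormal `u`, `v`. -/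
def riem (G : BilinField E) : TensorField E 4 :=
  fun x v => G x (curvOp G x (v 0) (v 1) (v 3)) (v 2)

variable [FiniteDimensional ℝ E]

/-- The Ricci tensor `r`. -/
def ricci (G : BilinField E) : TensorField E 2 :=
  fun x v => metricTrace G x fun a b => riem G x ![v 0, a, v 1, b]

/-- The scalar curvature `s`. -/
def scal (G : BilinField E) (x : E) : ℝ :=
  metricTrace G x fun a b => ricci G x ![a, b]

/-- The traceless Ricci tensor `z = r - (s / n) g`. -/
def tracelessRicci (G : BilinField E) : TensorField E 2 :=
  fun x v => ricci G x v - scal G x / (Module.finrank ℝ E : ℝ) * G x (v 0) (v 1)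

/-- The metric as a 2-tensor. -/
def metricTensor (G : BilinField E) : TensorField E 2 :=
  fun x v => G x (v 0) (v 1)

/-- The Kulkarni-Nomizu product of two symmetric 2-tensors. -/
def kulkarniNomizu (h k : TensorField E 2) : TensorField E 4 :=
  fun x v =>
    h x ![v 0, v 2] * k x ![v 1, v 3] + h x ![v 1, v 3] * k x ![v 0, v 2]
      - h x ![v 0, v 3] * k x ![v 1, v 2] - h x ![v 1, v 2] * k x ![v 0, v 3]

/-- The Weyl tensor `W`, from
`Rm = s / (2n(n-1)) g ∧ g + 1 / (n-2) z ∧ g + W` (`∧` the Kulkarni-Nomizu product). -/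
def weyl (G : BilinField E) : TensorField E 4 :=
  fun x v =>
    riem G x v
      - scal G x / (2 * (Module.finrank ℝ E : ℝ) * ((Module.finrank ℝ E : ℝ) - 1))
          * kulkarniNomizu (metricTensor G) (metricTensor G) x v
      - 1 / ((Module.finrank ℝ E : ℝ) - 2)
          * kulkarniNomizu (tracelessRicci G) (metricTensor G) x v

/-- `W̊r(X, Y) = ∑ᵢ r(W(X, Eᵢ)Y, Eᵢ) = ∑ᵢⱼ W(X, Eᵢ, Y, Eⱼ) r(Eᵢ, Eⱼ)` for an orthonormal
frame `{Eᵢ}`. -/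
def weylRicci (G : BilinField E) : TensorField E 2 :=
  fun x v =>
    metricTrace G x fun a a' => metricTrace G x fun b b' =>
      weyl G x ![v 0, a, v 1, b] * ricci G x ![a', b']

/-- The Bach tensor
`B(X, Y) = 1 / (n-3) ∑ᵢⱼ D_{Eᵢ} D_{Eⱼ} W(X, Eᵢ, Y, Eⱼ) + 1 / (n-2) W̊r(X, Y)`. -/
def bach (G : BilinField E) : TensorField E 2 :=
  fun x v =>
    1 / ((Module.finrank ℝ E : ℝ) - 3) * divSlot G 1 (divSlot G 3 (weyl G)) x v
      + 1 / ((Module.finrank ℝ E : ℝ) - 2) * weylRicci G x v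

/-- The complete divergence `div² B = ∑ᵢⱼ D_{Eⱼ} D_{Eᵢ} B(Eᵢ, Eⱼ)` of the Bach tensor. -/
def div2Bach (G : BilinField E) (x : E) : ℝ :=
  divSlot G 0 (divSlot G 0 (bach G)) x ![]

/-- The complete divergence
`div⁴ W = ∑ D_{Eⱼ} D_{Eₗ} D_{Eₖ} D_{Eᵢ} W(Eᵢ, Eⱼ, Eₖ, Eₗ)` of the Weyl tensor. After the first
divergence `(div W)(Y, Z, U) = ∑ᵢ D_{Eᵢ} W(Eᵢ, Y, Z, U)`, which is a multiple of the Cotton tensor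
`C(Z, U, Y)`, the arguments of `C` are contracted in the order `Z`, `U`, `Y`. -/
def div4Weyl (G : BilinField E) (x : E) : ℝ :=
  divSlot G 0 (divSlot G 1 (divSlot G 1 (divSlot G 0 (weyl G)))) x ![]

/-- The Hessian `Ddf` of a function. -/
def hessian (G : BilinField E) (f : E → ℝ) : TensorField E 2 :=
  covDeriv G (covDeriv G (k := 0) fun x _ => f x)

/-- The Laplacian `Δf = tr Ddf`. -/
def laplacian (G : BilinField E) (f : E → ℝ) (x : E) : ℝ :=
  metricTrace G x fun a b => hessian G f x ![a, b]

end Local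

/-! ### Riemannian manifolds

At a point `x` of the manifold every tensor is computed in the preferred chart at `x`; the tangent
space at `x` is identified with the model vector space `E` by this chart. -/

section Global

variable {E : Type*} [NormedAddCommGroup E] [NormedSpace ℝ E]
  {H : Type*} [TopologicalSpace H] {I : ModelWithCorners ℝ E H}
  {M : Type*} [TopologicalSpace M] [ChartedSpace H M] [IsManifold I ∞ M]

/-- Smooth Riemannian metrics on `M`. -/
abbrev RMetric (I : ModelWithCorners ℝ E H) (M : Type*) [TopologicalSpace M] [ChartedSpace H M]
    [IsManifold I ∞ M] :=
  Bundle.ContMDiffRiemannianMetric I ∞ E (fun x : M => TangentSpace I x)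

/-- The metric `g` read in the preferred chart `φ` at `x₀`: the pullback of `g` by `φ⁻¹`. -/
def chartMetric (g : RMetric I M) (x₀ : M) : BilinField E := fun y =>
  ContinuousLinearMap.bilinearComp (E := E) (F := E)
    (g.inner ((extChartAt I x₀).symm y))
    (mfderiv 𝓘(ℝ, E) I (extChartAt I x₀).symm y)
    (mfderiv 𝓘(ℝ, E) I (extChartAt I x₀).symm y)

/-- Completeness of the Riemannian distance: every Cauchy sequence converges. -/
def IsComplete (g : RMetric I M) : Prop :=
  letI : Bundle.RiemannianBundle (fun x : M => TangentSpace I x) := ⟨g.toRiemannianMetric⟩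
  ∀ u : ℕ → M,
    (∀ ε > 0, ∃ N, ∀ i ≥ N, ∀ j ≥ N, Manifold.riemannianEDist I (u i) (u j) < ε) →
      ∃ x, Filter.Tendsto u Filter.atTop (nhds x)

variable [FiniteDimensional ℝ E]

/-- The function `f` is a solution of the vacuum static equations
`Δf = - s / (n-1) f` and `Ddf - (r - s / (n-1) g) f = 0`. -/
def SolvesVacuumStatic (g : RMetric I M) (f : M → ℝ) : Prop :=
  ∀ x : M,
    let G := chartMetric g x
    let F : E → ℝ := f ∘ (extChartAt I x).symm
    let y := extChartAt I x x
    let n : ℝ := Module.finrank ℝ E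
    laplacian G F y = - (scal G y / (n - 1)) * f x ∧
      ∀ u v : E,
        hessian G F y ![u, v] - (ricci G y ![u, v] - scal G y / (n - 1) * G y u v) * f x = 0

/-- `(M, g)` is a vacuum static space: it is complete and the vacuum static equations have a
smooth solution that is not identically zero. -/
def IsVacuumStatic (g : RMetric I M) : Prop :=
  IsComplete g ∧
    ∃ f : M → ℝ, ContMDiff I 𝓘(ℝ, ℝ) ∞ f ∧ (∃ x, f x ≠ 0) ∧ SolvesVacuumStatic g f

/-- The Bach tensor at `x`, a bilinear form on the tangent space at `x`. -/
def bachAt (g : RMetric I M) (x : M) (u v : TangentSpace I x) : ℝ :=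
  bach (E := E) (chartMetric g x) (extChartAt I x x) ![u, v]

/-- The Bach tensor vanishes identically. -/
def IsBachFlat (g : RMetric I M) : Prop :=
  ∀ (x : M) (u v : TangentSpace I x), bachAt g x u v = 0

/-- `div² B = 0` on `M`. -/
def Div2BachVanishes (g : RMetric I M) : Prop :=
  ∀ x : M, div2Bach (chartMetric g x) (extChartAt I x x) = 0

/-- `div⁴ W = 0` on `M`. -/
def Div4WeylVanishes (g : RMetric I M) : Prop :=
  ∀ x : M, div4Weyl (chartMetric g x) (extChartAt I x x) = 0

/-- A vacuum static space with `div² B = 0`, `div⁴ W = 0` and `B ≠ 0`. -/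
def IsExample (g : RMetric I M) : Prop :=
  IsVacuumStatic g ∧ Div2BachVanishes g ∧ Div4WeylVanishes g ∧ ¬ IsBachFlat g

end Global

/-! ### Products of round spheres -/

/-- The unit sphere `S^p` in `ℝ^(p+1)`. -/
abbrev Sph (p : ℕ) : Type := Metric.sphere (0 : EuclideanSpace ℝ (Fin (p + 1))) 1

/-- A tangent vector of the sphere, as a vector of the ambient Euclidean space. -/
def ambientVec {p : ℕ} (x : Sph p) (u : TangentSpace (𝓡 p) x) : EuclideanSpace ℝ (Fin (p + 1)) :=
  mfderiv (𝓡 p) 𝓘(ℝ, EuclideanSpace ℝ (Fin (p + 1)))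
    (fun z : Sph p => (z : EuclideanSpace ℝ (Fin (p + 1)))) x u

/-- The round metric of the unit sphere `S^p`: the restriction of the Euclidean inner product. -/
def roundInner {p : ℕ} (x : Sph p) (u v : TangentSpace (𝓡 p) x) : ℝ :=
  inner ℝ (ambientVec x u) (ambientVec x v)

/-- `g` is the product metric of `S^p(c₁) × S^q(c₂)`, where `S^p(c)` is the round sphere of
constant sectional curvature `c > 0`, i.e. of radius `1 / √c`, written as the unit sphere with its
metric multiplied by `1 / c`. -/
def IsRoundProduct {p q : ℕ} (c₁ c₂ : ℝ) (g : RMetric ((𝓡 p).prod (𝓡 q)) (Sph p × Sph q)) : Prop :=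
  ∀ (x : Sph p × Sph q) (u v : TangentSpace ((𝓡 p).prod (𝓡 q)) x),
    g.inner x u v
      = 1 / c₁ * roundInner x.1 (Prod.fst u) (Prod.fst v)
        + 1 / c₂ * roundInner x.2 (Prod.snd u) (Prod.snd v)

end StaticSpace

end

noncomputable section

set_option linter.unusedSectionVars false

namespace StaticSpace

/-! ### Traces and covariant derivatives -/

section LocalCalculus

variable {E : Type*} [NormedAddCommGroup E] [NormedSpace ℝ E]

/-! On $S^p(c_1)\times S^q(c_2)$ the metrics $h_1,h_2$ of the factors are parallel. The Weyl tensor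
is a combination of $h_1\owedge h_1$, $h_1\owedge h_2$, $h_2\owedge h_2$ with constant coefficients,
hence parallel. So the divergence term of the Bach tensor vanishes, $B=\alpha h_1+\beta h_2$ with
constant $\alpha,\beta$, and $\mathrm{div}^2B$ and $\mathrm{div}^4\mathcal W$ vanish whatever the
order of the contractions (`exists_weyl_modelMetric`, `exists_bach_modelMetric`). Since $\mathcal W$
is trace-free, $\alpha$ is a nonzero multiple of $(p-1)c_1-(q-1)c_2$: it vanishes only for an
Einstein product.

A linear function on the ambient space of the first sphere restricts to $f$ with $Ddf=-c_1fh_1$. The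
static equations for $f$ then reduce to $(q-1)c_2=pc_1$, which gives $s/(n-1)=pc_1$ and $\alpha\ne0$
(`vacuumStatic_modelMetric`). Both families of the theorem satisfy this relation.

The bridge to the manifold is `chartMetric_roundProduct`: the preferred chart of a unit sphere at
$x$ is stereographic projection from $-x$, so in every preferred chart the product metric is the
same explicit field `modelMetric`, on the whole vector space, and the base point is the origin.
Curvature and parallelism are computed at all points of this model, the static equations only at its
origin. -/

lemma covDeriv_zero_left (G : BilinField E) {k : ℕ} :
    covDeriv G (0 : TensorField E k) = 0 := by
  funext x w
  simp [covDeriv]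

lemma covDeriv_two_apply (G : BilinField E) (T : TensorField E 2) (x u v w : E) :
    covDeriv G T x ![u, v, w] = fderiv ℝ (fun y => T y ![v, w]) x u
      - T x ![christoffel G x u v, w] - T x ![v, christoffel G x u w] := by
  have h0 : Function.update ![v, w] 0 (christoffel G x u v) = ![christoffel G x u v, w] := by
    ext i; fin_cases i <;> rfl
  have h1 : Function.update ![v, w] 1 (christoffel G x u w) = ![v, christoffel G x u w] := by
    ext i; fin_cases i <;> rfl
  have ht : Fin.tail ![u, v, w] = ![v, w] := rfl
  simp only [covDeriv, ht, Fin.sum_univ_two, Matrix.cons_val, h0, h1]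
  ring

lemma covDeriv_four_apply (G : BilinField E) (T : TensorField E 4) (x u a b c d : E) :
    covDeriv G T x ![u, a, b, c, d] = fderiv ℝ (fun y => T y ![a, b, c, d]) x u
      - T x ![christoffel G x u a, b, c, d] - T x ![a, christoffel G x u b, c, d]
      - T x ![a, b, christoffel G x u c, d] - T x ![a, b, c, christoffel G x u d] := by
  have h0 : Function.update ![a, b, c, d] 0 (christoffel G x u a)
      = ![christoffel G x u a, b, c, d] := by
    ext i; fin_cases i <;> rfl
  have h1 : Function.update ![a, b, c, d] 1 (christoffel G x u b)
      = ![a, christoffel G x u b, c, d] := by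
    ext i; fin_cases i <;> rfl
  have h2 : Function.update ![a, b, c, d] 2 (christoffel G x u c)
      = ![a, b, christoffel G x u c, d] := by
    ext i; fin_cases i <;> rfl
  have h3 : Function.update ![a, b, c, d] 3 (christoffel G x u d)
      = ![a, b, c, christoffel G x u d] := by
    ext i; fin_cases i <;> rfl
  have ht : Fin.tail ![u, a, b, c, d] = ![a, b, c, d] := rfl
  simp only [covDeriv, ht, Fin.sum_univ_four, Matrix.cons_val, h0, h1, h2, h3]
  ring

/-- A differentiable tensor field with vanishing covariant derivative. -/
structure IsParallel (G : BilinField E) {k : ℕ} (T : TensorField E k) : Prop where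
  differentiable : ∀ v, Differentiable ℝ fun y => T y v
  covDeriv_eq_zero : covDeriv G T = 0

lemma IsParallel.add {G : BilinField E} {k : ℕ} {S T : TensorField E k}
    (hS : IsParallel G S) (hT : IsParallel G T) : IsParallel G (S + T) := by
  refine ⟨fun v => (hS.differentiable v).add (hT.differentiable v), ?_⟩
  have h : covDeriv G (S + T) = covDeriv G S + covDeriv G T := by
    funext x w
    simp only [covDeriv, Pi.add_apply]
    rw [fderiv_fun_add (hS.differentiable _ x) (hT.differentiable _ x), Finset.sum_add_distrib,
      add_apply]
    ring
  rw [h, hS.covDeriv_eq_zero, hT.covDeriv_eq_zero, add_zero]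

lemma IsParallel.const_smul {G : BilinField E} {k : ℕ} {T : TensorField E k}
    (hT : IsParallel G T) (c : ℝ) : IsParallel G (c • T) := by
  refine ⟨fun v => (hT.differentiable v).const_smul c, ?_⟩
  have h : covDeriv G (c • T) = c • covDeriv G T := by
    funext x w
    simp only [covDeriv, Pi.smul_apply]
    rw [fderiv_fun_const_smul (hT.differentiable _ x), smul_apply, smul_sub, Finset.smul_sum]
  rw [h, hT.covDeriv_eq_zero, smul_zero]

/-- The Kulkarni-Nomizu product of parallel tensors is parallel. -/
lemma IsParallel.kulkarniNomizu {G : BilinField E} {h k : TensorField E 2}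
    (Ph : IsParallel G h) (Pk : IsParallel G k) : IsParallel G (kulkarniNomizu h k) := by
  obtain ⟨hd, h0⟩ := Ph
  obtain ⟨kd, k0⟩ := Pk
  refine ⟨fun v => ((((hd _).mul (kd _)).add ((hd _).mul (kd _))).sub ((hd _).mul (kd _))).sub
    ((hd _).mul (kd _)), ?_⟩
  have hh : ∀ x u v w, fderiv ℝ (fun y => h y ![v, w]) x u
      = h x ![christoffel G x u v, w] + h x ![v, christoffel G x u w] := fun x u v w => by
    have := covDeriv_two_apply G h x u v w
    rw [h0] at this
    simp only [Pi.zero_apply] at this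
    linarith
  have hk : ∀ x u v w, fderiv ℝ (fun y => k y ![v, w]) x u
      = k x ![christoffel G x u v, w] + k x ![v, christoffel G x u w] := fun x u v w => by
    have := covDeriv_two_apply G k x u v w
    rw [k0] at this
    simp only [Pi.zero_apply] at this
    linarith
  funext x w
  obtain ⟨u, a, b, c, d, rfl⟩ : ∃ u a b c d, w = ![u, a, b, c, d] :=
    ⟨w 0, w 1, w 2, w 3, w 4, by ext i; fin_cases i <;> rfl⟩
  have hf : HasFDerivAt (fun y => StaticSpace.kulkarniNomizu h k y ![a, b, c, d]) _ x :=
    ((((hd ![a, c] x).hasFDerivAt.mul (kd ![b, d] x).hasFDerivAt).add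
      ((hd ![b, d] x).hasFDerivAt.mul (kd ![a, c] x).hasFDerivAt)).sub
      ((hd ![a, d] x).hasFDerivAt.mul (kd ![b, c] x).hasFDerivAt)).sub
      ((hd ![b, c] x).hasFDerivAt.mul (kd ![a, d] x).hasFDerivAt)
  rw [covDeriv_four_apply, hf.fderiv]
  simp only [StaticSpace.kulkarniNomizu, Matrix.cons_val, FunLike.coe_add, FunLike.coe_sub,
    FunLike.coe_smul, Pi.add_apply, Pi.sub_apply, Pi.smul_apply, smul_eq_mul, hh, hk, Pi.zero_apply]
  ring

lemma fderiv_smul_add_smul {F : Type*} [NormedAddCommGroup F] [NormedSpace ℝ F]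
    {a b : E → ℝ} {a' b' : E →L[ℝ] ℝ} {x : E}
    (ha : HasFDerivAt a a' x) (hb : HasFDerivAt b b' x) (A B : F) (u : E) :
    fderiv ℝ (fun y => a y • A + b y • B) x u = a' u • A + b' u • B := by
  have h : HasFDerivAt (fun y => a y • A + b y • B) _ x := (ha.smul_const A).add (hb.smul_const B)
  rw [h.fderiv]
  rfl

lemma fderiv_smul_add_smul_apply {a b : E → ℝ} {a' b' : E →L[ℝ] ℝ} {x : E}
    (ha : HasFDerivAt a a' x) (hb : HasFDerivAt b b' x) (A B : E →L[ℝ] E →L[ℝ] ℝ) (u v w : E) :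
    fderiv ℝ (fun y => a y • A + b y • B) x u v w = a' u * A v w + b' u * B v w :=
  DFunLike.congr_fun (DFunLike.congr_fun (fderiv_smul_add_smul ha hb A B u) v) w

variable [FiniteDimensional ℝ E]

lemma metricTrace_add (G : BilinField E) (x : E) (b b' : E → E → ℝ) :
    metricTrace G x (fun u v => b u v + b' u v) = metricTrace G x b + metricTrace G x b' :=
  Finset.sum_add_distrib

lemma metricTrace_sub (G : BilinField E) (x : E) (b b' : E → E → ℝ) :
    metricTrace G x (fun u v => b u v - b' u v) = metricTrace G x b - metricTrace G x b' :=
  Finset.sum_sub_distrib _ _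

lemma metricTrace_const_mul (G : BilinField E) (x : E) (c : ℝ) (b : E → E → ℝ) :
    metricTrace G x (fun u v => c * b u v) = c * metricTrace G x b :=
  (Finset.mul_sum _ _ _).symm

lemma metricTrace_zero (G : BilinField E) (x : E) : metricTrace G x (fun _ _ => 0) = 0 :=
  Finset.sum_const_zero

lemma divSlot_eq_zero {G : BilinField E} {k : ℕ} {T : TensorField E (k + 1)}
    (hT : covDeriv G T = 0) (j : Fin (k + 1)) : divSlot G j T = 0 := by
  funext x v
  simp [divSlot, hT, metricTrace_zero]

/-- The trace of the form `G(A ·, ·)` is the trace of `A`. -/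
lemma metricTrace_apply_linearMap {G : BilinField E} {x : E} (hG : (G x).IsInvertible)
    (hs : ∀ u v, G x u v = G x v u) (A : E →ₗ[ℝ] E) :
    metricTrace G x (fun a b => G x (A a) b) = LinearMap.trace ℝ E A := by
  rw [LinearMap.trace_eq_matrix_trace ℝ (Module.finBasis ℝ E), Matrix.trace]
  refine Finset.sum_congr rfl fun i _ => ?_
  beta_reduce
  rw [hs, hG.self_apply_inverse]
  simp [LinearMap.toMatrix_apply]

/-- The numbers `G x v ((G x).inverse eⁱ)` are the coordinates of `v`, so the sum is `G x u` applied
to the basis expansion of `v`. Applied to projections of `u` and `v` to the factors, it gives every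
contraction of two factor metrics. -/
lemma metricTrace_apply_mul_apply {G : BilinField E} {x : E} (hG : (G x).IsInvertible)
    (hs : ∀ u v, G x u v = G x v u) (u v : E) :
    metricTrace G x (fun a b => G x u a * G x v b) = G x u v := by
  conv_rhs => rw [← (Module.finBasis ℝ E).sum_repr v, map_sum]
  refine Finset.sum_congr rfl fun i _ => ?_
  beta_reduce
  rw [hs v, hG.self_apply_inverse]
  simp [mul_comm]

end LocalCalculus

/-! ### The conformal factor of a round metric in stereographic coordinates -/

section Conformal

variable {V : Type*} [NormedAddCommGroup V]

/-- The factor `2 / (‖y‖² + 4)`. -/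
def stereoFactor (y : V) : ℝ := 2 / (‖y‖ ^ 2 + 4)

/-- The conformal factor `16 / (c (‖y‖² + 4)²)` of the metric of constant curvature `c` in
stereographic coordinates. -/
def roundFactor (c : ℝ) (y : V) : ℝ := 4 / c * stereoFactor y ^ 2

lemma stereoFactor_pos (y : V) : 0 < stereoFactor y := by
  unfold stereoFactor; positivity

lemma roundFactor_pos {c : ℝ} (hc : 0 < c) (y : V) : 0 < roundFactor c y := by
  have := stereoFactor_pos y
  unfold roundFactor; positivity

variable [InnerProductSpace ℝ V]

/-- This relation eliminates `‖y‖ ^ 2`, both in the curvature computation and in the conformality of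
inverse stereographic projection. -/
lemma stereoFactor_mul_inner_self (y : V) :
    stereoFactor y * inner ℝ y y = 2 - 4 * stereoFactor y := by
  have : (‖y‖ ^ 2 + 4) ≠ 0 := by positivity
  rw [real_inner_self_eq_norm_sq, stereoFactor]
  field_simp
  ring

lemma hasFDerivAt_stereoFactor (y : V) :
    HasFDerivAt stereoFactor (-(stereoFactor y ^ 2) • innerSL ℝ y) y := by
  have h : (‖y‖ ^ 2 + 4) ≠ 0 := by positivity
  have h1 : HasFDerivAt (fun y : V => ‖y‖ ^ 2 + 4) (2 • innerSL ℝ y) y :=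
    (hasStrictFDerivAt_norm_sq y).hasFDerivAt.add_const 4
  have h2 := ((hasDerivAt_inv h).comp_hasFDerivAt y h1).const_mul 2
  refine h2.congr_fderiv ?_
  ext u
  simp [stereoFactor]
  field_simp

/-- Writing the factor as $e^{2\varphi}$, this says $d\varphi=-\sigma\langle y,\cdot\rangle$ with
$\sigma$ = `stereoFactor`. The conformal formula $\Gamma(u,v)=d\varphi(u)v+d\varphi(v)u-\langle
u,v\rangle\nabla\varphi$ then yields `roundGamma`, which does not depend on `c`. -/
lemma hasFDerivAt_roundFactor (c : ℝ) (y : V) :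
    HasFDerivAt (roundFactor c) (-(2 * stereoFactor y * roundFactor c y) • innerSL ℝ y) y := by
  have h := ((hasFDerivAt_stereoFactor y).pow 2).const_mul (4 / c)
  refine h.congr_fderiv ?_
  ext u
  simp [roundFactor]
  ring

/-- The Christoffel symbols of a round metric in stereographic coordinates. -/
def roundGamma (y u v : V) : V :=
  -stereoFactor y • ((inner ℝ y u : ℝ) • v + (inner ℝ y v : ℝ) • u - (inner ℝ u v : ℝ) • y)

lemma hasFDerivAt_roundGamma (y v w : V) :
    HasFDerivAt (fun y => roundGamma y v w)
      (-stereoFactor y • ((innerSL ℝ v).smulRight w + (innerSL ℝ w).smulRight v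
          - (inner ℝ v w : ℝ) • ContinuousLinearMap.id ℝ V)
        + (stereoFactor y ^ 2 • innerSL ℝ y).smulRight
          ((inner ℝ y v : ℝ) • w + (inner ℝ y w : ℝ) • v - (inner ℝ v w : ℝ) • y)) y := by
  have hi : ∀ v : V, HasFDerivAt (fun y : V => (inner ℝ y v : ℝ)) (innerSL ℝ v) y := fun v => by
    have := (innerSL ℝ v).hasFDerivAt (x := y)
    refine this.congr_of_eventuallyEq (Filter.Eventually.of_forall fun z => ?_)
    simp [real_inner_comm]
  have h := (hasFDerivAt_stereoFactor y).neg.smul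
    ((((hi v).smul_const w).add ((hi w).smul_const v)).sub
      ((hasFDerivAt_id y).const_smul (inner ℝ v w : ℝ)))
  refine h.congr_fderiv ?_
  ext u
  simp

/-- Metric compatibility: multiplied by `roundFactor c y`, the right side is the derivative along
`u` of the conformal metric evaluated on `v`, `w`. -/
lemma inner_roundGamma_add (y u v w : V) :
    inner ℝ (roundGamma y u v) w + inner ℝ v (roundGamma y u w)
      = -(2 * stereoFactor y) * inner ℝ y u * inner ℝ v w := by
  simp only [roundGamma, inner_add_left, inner_sub_left, inner_smul_left, inner_add_right,
    inner_sub_right, inner_smul_right, RCLike.conj_to_real, real_inner_comm y v,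
    real_inner_comm u v]
  ring

/-- The metric has constant curvature. -/
lemma roundGamma_curvature (y u v w : V) :
    fderiv ℝ (fun y => roundGamma y v w) y u - fderiv ℝ (fun y => roundGamma y u w) y v
        + roundGamma y u (roundGamma y v w) - roundGamma y v (roundGamma y u w)
      = (4 * stereoFactor y ^ 2) • ((inner ℝ v w : ℝ) • u - (inner ℝ u w : ℝ) • v) := by
  rw [(hasFDerivAt_roundGamma y v w).fderiv, (hasFDerivAt_roundGamma y u w).fderiv]
  have h := stereoFactor_mul_inner_self y
  -- The terms quadratic in `roundGamma` contribute $\sigma^2|y|^2$, which has to be traded for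
  -- powers of $\sigma$ before the two sides agree.
  have h2 : stereoFactor y ^ 2 * inner ℝ y y = 2 * stereoFactor y - 4 * stereoFactor y ^ 2 := by
    linear_combination stereoFactor y * h
  simp only [roundGamma, inner_add_right, inner_sub_right, inner_smul_right, add_apply, sub_apply,
    smul_apply, ContinuousLinearMap.smulRight_apply, innerSL_apply_apply, smul_eq_mul,
    ContinuousLinearMap.id_apply, real_inner_comm v u, real_inner_comm w u, real_inner_comm w v,
    real_inner_comm y u, real_inner_comm y v]
  linear_combination (norm := module) h2 • ((inner ℝ w u : ℝ) • v - (inner ℝ w v : ℝ) • u)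

end Conformal


/-! ### Products of two round metrics in stereographic coordinates -/

section Model

variable {V W : Type*} [NormedAddCommGroup V] [InnerProductSpace ℝ V]
  [NormedAddCommGroup W] [InnerProductSpace ℝ W]

/-- The metric of the first factor, as a bilinear form on the product. -/
def fstForm (c : ℝ) (x u v : V × W) : ℝ := roundFactor c x.1 * inner ℝ u.1 v.1

/-- The metric of the second factor, as a bilinear form on the product. -/
def sndForm (c : ℝ) (x u v : V × W) : ℝ := roundFactor c x.2 * inner ℝ u.2 v.2

/-- The metric of the first factor, as a tensor on the product. -/
def fstTensor (c : ℝ) : TensorField (V × W) 2 := fun x v => fstForm c x (v 0) (v 1)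

/-- The metric of the second factor, as a tensor on the product. -/
def sndTensor (c : ℝ) : TensorField (V × W) 2 := fun x v => sndForm c x (v 0) (v 1)

/-- The inner product of the first factor, as a bilinear form on the product. -/
def fstInner (V W : Type*) [NormedAddCommGroup V] [InnerProductSpace ℝ V]
    [NormedAddCommGroup W] [InnerProductSpace ℝ W] : (V × W) →L[ℝ] (V × W) →L[ℝ] ℝ :=
  (innerSL ℝ (E := V)).bilinearComp (ContinuousLinearMap.fst ℝ V W)
    (ContinuousLinearMap.fst ℝ V W)

/-- The inner product of the second factor, as a bilinear form on the product. -/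
def sndInner (V W : Type*) [NormedAddCommGroup V] [InnerProductSpace ℝ V]
    [NormedAddCommGroup W] [InnerProductSpace ℝ W] : (V × W) →L[ℝ] (V × W) →L[ℝ] ℝ :=
  (innerSL ℝ (E := W)).bilinearComp (ContinuousLinearMap.snd ℝ V W)
    (ContinuousLinearMap.snd ℝ V W)

@[simp] lemma fstInner_apply (u v : V × W) : fstInner V W u v = inner ℝ u.1 v.1 := rfl

@[simp] lemma sndInner_apply (u v : V × W) : sndInner V W u v = inner ℝ u.2 v.2 := rfl

/-- The product of the round metrics of curvatures `c₁` and `c₂` in stereographic coordinates. -/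
def modelMetric (c₁ c₂ : ℝ) : BilinField (V × W) := fun x =>
  roundFactor c₁ x.1 • fstInner V W + roundFactor c₂ x.2 • sndInner V W

lemma modelMetric_apply (c₁ c₂ : ℝ) (x u v : V × W) :
    modelMetric c₁ c₂ x u v = fstForm c₁ x u v + sndForm c₂ x u v := rfl

lemma fstForm_comm (c : ℝ) (x u v : V × W) : fstForm c x u v = fstForm c x v u := by
  rw [fstForm, fstForm, real_inner_comm]

lemma sndForm_comm (c : ℝ) (x u v : V × W) : sndForm c x u v = sndForm c x v u := by
  rw [sndForm, sndForm, real_inner_comm]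

lemma modelMetric_comm (c₁ c₂ : ℝ) (x u v : V × W) :
    modelMetric c₁ c₂ x u v = modelMetric c₁ c₂ x v u := by
  rw [modelMetric_apply, modelMetric_apply, fstForm_comm, sndForm_comm]

/-- The degenerate form is the full metric composed with a projection, so its traces become traces
of linear maps. -/
lemma fstForm_eq (c₁ c₂ : ℝ) (x u v : V × W) :
    fstForm c₁ x u v = modelMetric c₁ c₂ x (u.1, 0) v := by
  simp [modelMetric_apply, fstForm, sndForm]

lemma sndForm_eq (c₁ c₂ : ℝ) (x u v : V × W) :
    sndForm c₂ x u v = modelMetric c₁ c₂ x (0, u.2) v := by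
  simp [modelMetric_apply, fstForm, sndForm]

lemma hasFDerivAt_roundFactor_fst (c : ℝ) (x : V × W) :
    HasFDerivAt (fun y : V × W => roundFactor c y.1)
      ((-(2 * stereoFactor x.1 * roundFactor c x.1) • innerSL ℝ x.1).comp
        (ContinuousLinearMap.fst ℝ V W)) x :=
  (hasFDerivAt_roundFactor c x.1).comp x hasFDerivAt_fst

lemma hasFDerivAt_roundFactor_snd (c : ℝ) (x : V × W) :
    HasFDerivAt (fun y : V × W => roundFactor c y.2)
      ((-(2 * stereoFactor x.2 * roundFactor c x.2) • innerSL ℝ x.2).comp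
        (ContinuousLinearMap.snd ℝ V W)) x :=
  (hasFDerivAt_roundFactor c x.2).comp x hasFDerivAt_snd

lemma fderiv_modelMetric_apply (c₁ c₂ : ℝ) (x u v w : V × W) :
    fderiv ℝ (modelMetric c₁ c₂) x u v w
      = -(2 * stereoFactor x.1 * roundFactor c₁ x.1) * inner ℝ x.1 u.1 * inner ℝ v.1 w.1
        - 2 * stereoFactor x.2 * roundFactor c₂ x.2 * inner ℝ x.2 u.2 * inner ℝ v.2 w.2 := by
  refine (fderiv_smul_add_smul_apply (hasFDerivAt_roundFactor_fst c₁ x)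
    (hasFDerivAt_roundFactor_snd c₂ x) (fstInner V W) (sndInner V W) u v w).trans ?_
  simp
  ring

lemma differentiable_fstTensor (c : ℝ) (v : Fin 2 → V × W) :
    Differentiable ℝ fun y => fstTensor c y v := fun y =>
  ((hasFDerivAt_roundFactor_fst c y).mul_const _).differentiableAt

lemma differentiable_sndTensor (c : ℝ) (v : Fin 2 → V × W) :
    Differentiable ℝ fun y => sndTensor c y v := fun y =>
  ((hasFDerivAt_roundFactor_snd c y).mul_const _).differentiableAt

variable [FiniteDimensional ℝ V] [FiniteDimensional ℝ W]

/-- Positive definiteness gives injectivity, and the dimensions agree. Since `inverse` is zero on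
non-invertible maps, Christoffel symbols and traces have their intended meaning only after this. -/
lemma modelMetric_isInvertible {c₁ c₂ : ℝ} (h₁ : 0 < c₁) (h₂ : 0 < c₂) (x : V × W) :
    (modelMetric c₁ c₂ x).IsInvertible := by
  have hinj : Function.Injective (modelMetric c₁ c₂ x) := by
    rw [injective_iff_map_eq_zero]
    intro u hu
    have h : modelMetric c₁ c₂ x u u = 0 := by rw [hu]; rfl
    rw [modelMetric_apply, fstForm, sndForm, real_inner_self_eq_norm_sq,
      real_inner_self_eq_norm_sq] at h
    have f1 := roundFactor_pos h₁ x.1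
    have f2 := roundFactor_pos h₂ x.2
    have n1 : roundFactor c₁ x.1 * ‖u.1‖ ^ 2 = 0 := by
      nlinarith [mul_nonneg f1.le (sq_nonneg ‖u.1‖), mul_nonneg f2.le (sq_nonneg ‖u.2‖)]
    have n2 : roundFactor c₂ x.2 * ‖u.2‖ ^ 2 = 0 := by linarith
    ext1
    · simpa [f1.ne'] using n1
    · simpa [f2.ne'] using n2
  have hfr : Module.finrank ℝ (V × W) = Module.finrank ℝ ((V × W) →L[ℝ] ℝ) := by
    rw [← (LinearMap.toContinuousLinearMap (𝕜 := ℝ) (E := V × W) (F' := ℝ)).finrank_eq]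
    exact Subspace.dual_finrank_eq.symm
  refine ⟨(LinearEquiv.ofInjectiveOfFinrankEq (modelMetric c₁ c₂ x).toLinearMap hinj
    hfr).toContinuousLinearEquiv, ?_⟩
  exact ContinuousLinearMap.ext fun u => rfl

/-- The Christoffel symbols of a product split. -/
lemma christoffel_modelMetric {c₁ c₂ : ℝ} (h₁ : 0 < c₁) (h₂ : 0 < c₂) (x u v : V × W) :
    christoffel (modelMetric c₁ c₂) x u v
      = (roundGamma x.1 u.1 v.1, roundGamma x.2 u.2 v.2) := by
  -- Lowering the index turns the claim into the Koszul formula, tested against a vector `w`.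
  rw [christoffel, (modelMetric_isInvertible h₁ h₂ x).inverse_apply_eq]
  refine ContinuousLinearMap.ext fun w => ?_
  simp only [smul_apply, add_apply, sub_apply, ContinuousLinearMap.flip_apply,
    fderiv_modelMetric_apply, modelMetric_apply, fstForm, sndForm, roundGamma,
    inner_smul_left, inner_add_left, inner_sub_left, smul_eq_mul, RCLike.conj_to_real,
    inner_neg_left, neg_smul]
  ring

lemma curvOp_modelMetric {c₁ c₂ : ℝ} (h₁ : 0 < c₁) (h₂ : 0 < c₂) (x u v w : V × W) :
    curvOp (modelMetric c₁ c₂) x u v w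
      = ((4 * stereoFactor x.1 ^ 2) • ((inner ℝ v.1 w.1 : ℝ) • u.1 - (inner ℝ u.1 w.1 : ℝ) • v.1),
        (4 * stereoFactor x.2 ^ 2) •
          ((inner ℝ v.2 w.2 : ℝ) • u.2 - (inner ℝ u.2 w.2 : ℝ) • v.2)) := by
  have hd : ∀ u v w : V × W,
      fderiv ℝ (fun y : V × W => (roundGamma y.1 v.1 w.1, roundGamma y.2 v.2 w.2)) x u
        = (fderiv ℝ (fun y => roundGamma y v.1 w.1) x.1 u.1,
          fderiv ℝ (fun y => roundGamma y v.2 w.2) x.2 u.2) := fun u v w => by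
    have h := ((hasFDerivAt_roundGamma x.1 v.1 w.1).differentiableAt.hasFDerivAt.comp x
        (hasFDerivAt_fst (𝕜 := ℝ) (p := x))).prodMk
      ((hasFDerivAt_roundGamma x.2 v.2 w.2).differentiableAt.hasFDerivAt.comp x
        (hasFDerivAt_snd (𝕜 := ℝ) (p := x)))
    have h' := h.fderiv
    simp only [Function.comp_def] at h'
    rw [h']
    rfl
  simp only [curvOp, christoffel_modelMetric h₁ h₂, hd]
  ext1
  · exact roundGamma_curvature x.1 u.1 v.1 w.1
  · exact roundGamma_curvature x.2 u.2 v.2 w.2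

/-- The curvature factor `4 * stereoFactor ^ 2` equals `c * roundFactor c`, so lowering the index
leaves `c` times products of the factor metrics. -/
lemma riem_modelMetric {c₁ c₂ : ℝ} (h₁ : 0 < c₁) (h₂ : 0 < c₂) (x a b c d : V × W) :
    riem (modelMetric c₁ c₂) x ![a, b, c, d]
      = c₁ * (fstForm c₁ x a c * fstForm c₁ x b d - fstForm c₁ x b c * fstForm c₁ x a d)
        + c₂ * (sndForm c₂ x a c * sndForm c₂ x b d - sndForm c₂ x b c * sndForm c₂ x a d) := by
  simp only [riem, Matrix.cons_val, curvOp_modelMetric h₁ h₂, modelMetric_apply, fstForm, sndForm,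
    inner_smul_left, inner_sub_left, RCLike.conj_to_real, roundFactor]
  field_simp

lemma metricTrace_fstForm {c₁ c₂ : ℝ} (h₁ : 0 < c₁) (h₂ : 0 < c₂) (x : V × W) :
    metricTrace (modelMetric c₁ c₂) x (fun a b => fstForm c₁ x a b) = Module.finrank ℝ V := by
  have h := metricTrace_apply_linearMap (modelMetric_isInvertible h₁ h₂ x)
    (modelMetric_comm c₁ c₂ x) (LinearMap.prodMap LinearMap.id (0 : W →ₗ[ℝ] W))
  rw [LinearMap.trace_prodMap', LinearMap.trace_id, map_zero, add_zero] at h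
  rw [← h]
  congr with a b
  exact fstForm_eq c₁ c₂ x a b

lemma metricTrace_sndForm {c₁ c₂ : ℝ} (h₁ : 0 < c₁) (h₂ : 0 < c₂) (x : V × W) :
    metricTrace (modelMetric c₁ c₂) x (fun a b => sndForm c₂ x a b) = Module.finrank ℝ W := by
  have h := metricTrace_apply_linearMap (modelMetric_isInvertible h₁ h₂ x)
    (modelMetric_comm c₁ c₂ x) (LinearMap.prodMap (0 : V →ₗ[ℝ] V) LinearMap.id)
  rw [LinearMap.trace_prodMap', LinearMap.trace_id, map_zero, zero_add] at h
  rw [← h]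
  congr with a b
  exact sndForm_eq c₁ c₂ x a b

lemma metricTrace_fstForm_mul_fstForm {c₁ c₂ : ℝ} (h₁ : 0 < c₁) (h₂ : 0 < c₂) (x u v : V × W) :
    metricTrace (modelMetric c₁ c₂) x (fun a b => fstForm c₁ x u a * fstForm c₁ x v b)
      = fstForm c₁ x u v := by
  simp only [fstForm_eq c₁ c₂]
  rw [metricTrace_apply_mul_apply (modelMetric_isInvertible h₁ h₂ x) (modelMetric_comm c₁ c₂ x)]
  simp [modelMetric_apply, fstForm, sndForm]

lemma metricTrace_sndForm_mul_sndForm {c₁ c₂ : ℝ} (h₁ : 0 < c₁) (h₂ : 0 < c₂) (x u v : V × W) :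
    metricTrace (modelMetric c₁ c₂) x (fun a b => sndForm c₂ x u a * sndForm c₂ x v b)
      = sndForm c₂ x u v := by
  simp only [sndForm_eq c₁ c₂]
  rw [metricTrace_apply_mul_apply (modelMetric_isInvertible h₁ h₂ x) (modelMetric_comm c₁ c₂ x)]
  simp [modelMetric_apply, fstForm, sndForm]

lemma metricTrace_fstForm_mul_sndForm {c₁ c₂ : ℝ} (h₁ : 0 < c₁) (h₂ : 0 < c₂) (x u v : V × W) :
    metricTrace (modelMetric c₁ c₂) x (fun a b => fstForm c₁ x u a * sndForm c₂ x v b) = 0 := by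
  simp only [fstForm_eq c₁ c₂, sndForm_eq c₁ c₂]
  rw [metricTrace_apply_mul_apply (modelMetric_isInvertible h₁ h₂ x) (modelMetric_comm c₁ c₂ x)]
  simp [modelMetric_apply, fstForm, sndForm]

lemma metricTrace_sndForm_mul_fstForm {c₁ c₂ : ℝ} (h₁ : 0 < c₁) (h₂ : 0 < c₂) (x u v : V × W) :
    metricTrace (modelMetric c₁ c₂) x (fun a b => sndForm c₂ x u a * fstForm c₁ x v b) = 0 := by
  simp only [fstForm_eq c₁ c₂, sndForm_eq c₁ c₂]
  rw [metricTrace_apply_mul_apply (modelMetric_isInvertible h₁ h₂ x) (modelMetric_comm c₁ c₂ x)]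
  simp [modelMetric_apply, fstForm, sndForm]

/-- The Christoffel symbols split, so this is metric compatibility on the first factor alone. -/
lemma isParallel_fstTensor {c₁ c₂ : ℝ} (h₁ : 0 < c₁) (h₂ : 0 < c₂) :
    IsParallel (modelMetric c₁ c₂) (fstTensor (V := V) (W := W) c₁) := by
  refine ⟨differentiable_fstTensor c₁, ?_⟩
  funext x w
  obtain ⟨a, b, c, rfl⟩ : ∃ a b c, w = ![a, b, c] :=
    ⟨w 0, w 1, w 2, by ext1 i; fin_cases i <;> rfl⟩
  have h : HasFDerivAt (fun y => fstTensor (V := V) (W := W) c₁ y ![b, c]) _ x :=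
    (hasFDerivAt_roundFactor_fst c₁ x).mul_const _
  rw [covDeriv_two_apply, h.fderiv, christoffel_modelMetric h₁ h₂, christoffel_modelMetric h₁ h₂]
  simp only [fstTensor, fstForm, Matrix.cons_val, smul_apply, ContinuousLinearMap.comp_apply,
    ContinuousLinearMap.coe_fst', innerSL_apply_apply, smul_eq_mul, Pi.zero_apply]
  linear_combination -roundFactor c₁ x.1 * inner_roundGamma_add x.1 a.1 b.1 c.1

lemma isParallel_sndTensor {c₁ c₂ : ℝ} (h₁ : 0 < c₁) (h₂ : 0 < c₂) :
    IsParallel (modelMetric c₁ c₂) (sndTensor (V := V) (W := W) c₂) := by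
  refine ⟨differentiable_sndTensor c₂, ?_⟩
  funext x w
  obtain ⟨a, b, c, rfl⟩ : ∃ a b c, w = ![a, b, c] :=
    ⟨w 0, w 1, w 2, by ext1 i; fin_cases i <;> rfl⟩
  have h : HasFDerivAt (fun y => sndTensor (V := V) (W := W) c₂ y ![b, c]) _ x :=
    (hasFDerivAt_roundFactor_snd c₂ x).mul_const _
  rw [covDeriv_two_apply, h.fderiv, christoffel_modelMetric h₁ h₂, christoffel_modelMetric h₁ h₂]
  simp only [sndTensor, sndForm, Matrix.cons_val, smul_apply, ContinuousLinearMap.comp_apply,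
    ContinuousLinearMap.coe_snd', innerSL_apply_apply, smul_eq_mul, Pi.zero_apply]
  linear_combination -roundFactor c₂ x.2 * inner_roundGamma_add x.2 a.2 b.2 c.2

end Model

/-! ### Curvature of products of two round metrics -/

section ModelCurvature

variable {V W : Type*} [NormedAddCommGroup V] [InnerProductSpace ℝ V]
  [NormedAddCommGroup W] [InnerProductSpace ℝ W]
  [FiniteDimensional ℝ V] [FiniteDimensional ℝ W] {c₁ c₂ : ℝ}

lemma ricci_modelMetric (h₁ : 0 < c₁) (h₂ : 0 < c₂) (x u v : V × W) :
    ricci (modelMetric c₁ c₂) x ![u, v]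
      = ((Module.finrank ℝ V : ℝ) - 1) * c₁ * fstForm c₁ x u v
        + ((Module.finrank ℝ W : ℝ) - 1) * c₂ * sndForm c₂ x u v := by
  have h : ∀ a b : V × W, riem (modelMetric c₁ c₂) x ![u, a, v, b]
      = c₁ * (fstForm c₁ x u v * fstForm c₁ x a b - fstForm c₁ x v a * fstForm c₁ x u b)
        + c₂ * (sndForm c₂ x u v * sndForm c₂ x a b - sndForm c₂ x v a * sndForm c₂ x u b) :=
    fun a b => by
      rw [riem_modelMetric h₁ h₂, fstForm_comm c₁ x a v, sndForm_comm c₂ x a v]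
  simp only [ricci, Matrix.cons_val, h, metricTrace_add, metricTrace_const_mul, metricTrace_sub,
    metricTrace_fstForm h₁ h₂, metricTrace_sndForm h₁ h₂, metricTrace_fstForm_mul_fstForm h₁ h₂,
    metricTrace_sndForm_mul_sndForm h₁ h₂, fstForm_comm c₁ x v u, sndForm_comm c₂ x v u]
  ring

lemma scal_modelMetric (h₁ : 0 < c₁) (h₂ : 0 < c₂) (x : V × W) :
    scal (modelMetric c₁ c₂) x
      = (Module.finrank ℝ V : ℝ) * ((Module.finrank ℝ V : ℝ) - 1) * c₁
        + (Module.finrank ℝ W : ℝ) * ((Module.finrank ℝ W : ℝ) - 1) * c₂ := by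
  simp only [scal, ricci_modelMetric h₁ h₂, metricTrace_add, metricTrace_const_mul,
    metricTrace_fstForm h₁ h₂, metricTrace_sndForm h₁ h₂]
  ring

/-- The Weyl tensor of a product is a combination of Kulkarni-Nomizu products of the metrics of the
factors. -/
lemma exists_weyl_modelMetric (h₁ : 0 < c₁) (h₂ : 0 < c₂)
    (hV : 2 ≤ Module.finrank ℝ V) (hW : 2 ≤ Module.finrank ℝ W) :
    ∃ A B C : ℝ, 0 < A ∧
      2 * A * ((Module.finrank ℝ V : ℝ) - 1) + B * Module.finrank ℝ W = 0 ∧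
      weyl (modelMetric (V := V) (W := W) c₁ c₂)
        = A • kulkarniNomizu (fstTensor c₁) (fstTensor c₁)
          + B • kulkarniNomizu (fstTensor c₁) (sndTensor c₂)
          + C • kulkarniNomizu (sndTensor c₂) (sndTensor c₂) := by
  have hfr : (Module.finrank ℝ (V × W) : ℝ) = Module.finrank ℝ V + Module.finrank ℝ W := by
    rw [Module.finrank_prod]; push_cast; rfl
  have hp : (2 : ℝ) ≤ Module.finrank ℝ V := by exact_mod_cast hV
  have hq : (2 : ℝ) ≤ Module.finrank ℝ W := by exact_mod_cast hW
  set p : ℝ := (Module.finrank ℝ V : ℝ) with hpdef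
  set q : ℝ := (Module.finrank ℝ W : ℝ) with hqdef
  have n0 : p + q ≠ 0 := by linarith
  have n1 : p + q - 1 ≠ 0 := by linarith
  have n2 : p + q - 2 ≠ 0 := by linarith
  -- Coefficients found by comparison in the defining decomposition; all are multiples of `c₁ + c₂`,
  -- as the product with `c₂ = -c₁` is conformally flat. The relation between `A` and `B` is the
  -- first-factor part of the trace-freeness of the Weyl tensor.
  refine ⟨q * (q - 1) * (c₁ + c₂) / (2 * (p + q - 1) * (p + q - 2)),
    -((p - 1) * (q - 1) * (c₁ + c₂) / ((p + q - 1) * (p + q - 2))),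
    p * (p - 1) * (c₁ + c₂) / (2 * (p + q - 1) * (p + q - 2)), ?_, ?_, ?_⟩
  · have : 0 < q * (q - 1) := by nlinarith
    have : 0 < (p + q - 1) := by linarith
    have : 0 < (p + q - 2) := by linarith
    positivity
  · field_simp
    ring
  · funext x w
    obtain ⟨a, b, c, d, rfl⟩ : ∃ a b c d, w = ![a, b, c, d] :=
      ⟨w 0, w 1, w 2, w 3, by ext1 i; fin_cases i <;> rfl⟩
    simp only [weyl, riem_modelMetric h₁ h₂, scal_modelMetric h₁ h₂, kulkarniNomizu, tracelessRicci,
      ricci_modelMetric h₁ h₂, metricTensor, fstTensor, sndTensor, Matrix.cons_val,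
      modelMetric_apply, hfr, Pi.add_apply, Pi.smul_apply, smul_eq_mul, ← hpdef, ← hqdef]
    field_simp
    ring

lemma covDeriv_weyl_modelMetric (h₁ : 0 < c₁) (h₂ : 0 < c₂)
    (hV : 2 ≤ Module.finrank ℝ V) (hW : 2 ≤ Module.finrank ℝ W) :
    covDeriv (modelMetric c₁ c₂) (weyl (modelMetric (V := V) (W := W) c₁ c₂)) = 0 := by
  obtain ⟨A, B, C, -, -, h⟩ := exists_weyl_modelMetric (V := V) (W := W) h₁ h₂ hV hW
  have e₁ := isParallel_fstTensor (V := V) (W := W) h₁ h₂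
  have e₂ := isParallel_sndTensor (V := V) (W := W) h₁ h₂
  rw [h]
  exact ((((e₁.kulkarniNomizu e₁).const_smul A).add ((e₁.kulkarniNomizu e₂).const_smul B)).add
    ((e₂.kulkarniNomizu e₂).const_smul C)).covDeriv_eq_zero

lemma div4Weyl_modelMetric (h₁ : 0 < c₁) (h₂ : 0 < c₂)
    (hV : 2 ≤ Module.finrank ℝ V) (hW : 2 ≤ Module.finrank ℝ W) (x : V × W) :
    div4Weyl (modelMetric c₁ c₂) x = 0 := by
  rw [div4Weyl, divSlot_eq_zero (covDeriv_weyl_modelMetric h₁ h₂ hV hW),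
    divSlot_eq_zero (covDeriv_zero_left _), divSlot_eq_zero (covDeriv_zero_left _),
    divSlot_eq_zero (covDeriv_zero_left _)]
  rfl

/-- The Bach tensor of a product is a combination of the metrics of the factors. -/
lemma exists_bach_modelMetric (h₁ : 0 < c₁) (h₂ : 0 < c₂)
    (hV : 2 ≤ Module.finrank ℝ V) (hW : 2 ≤ Module.finrank ℝ W)
    (hne : ((Module.finrank ℝ V : ℝ) - 1) * c₁ ≠ ((Module.finrank ℝ W : ℝ) - 1) * c₂) :
    ∃ α β : ℝ, α ≠ 0 ∧
      bach (modelMetric (V := V) (W := W) c₁ c₂) = α • fstTensor c₁ + β • sndTensor c₂ := by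
  obtain ⟨A, B, C, hA, hAB, h⟩ := exists_weyl_modelMetric (V := V) (W := W) h₁ h₂ hV hW
  have hfr : (Module.finrank ℝ (V × W) : ℝ) = Module.finrank ℝ V + Module.finrank ℝ W := by
    rw [Module.finrank_prod]; push_cast; rfl
  have hp : (2 : ℝ) ≤ Module.finrank ℝ V := by exact_mod_cast hV
  have hq : (2 : ℝ) ≤ Module.finrank ℝ W := by exact_mod_cast hW
  set p : ℝ := (Module.finrank ℝ V : ℝ) with hpdef
  set q : ℝ := (Module.finrank ℝ W : ℝ) with hqdef
  -- With Ricci eigenvalues $r_1,r_2$, contraction gives $2A(p-1)r_1+Bqr_2$ on the first factor, and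
  -- trace-freeness turns it into $2A(p-1)(r_1-r_2)$. The second coefficient is left as it comes.
  refine ⟨1 / (p + q - 2) * (2 * A * (p - 1) * ((p - 1) * c₁ - (q - 1) * c₂)),
    1 / (p + q - 2) * (2 * C * ((q - 1) * c₂) * (q - 1) + B * ((p - 1) * c₁) * p), ?_, ?_⟩
  · refine mul_ne_zero (one_div_ne_zero (by linarith)) (mul_ne_zero (mul_ne_zero ?_ ?_) ?_)
    · positivity
    · linarith
    · exact sub_ne_zero.2 hne
  · funext x w
    obtain ⟨u, v, rfl⟩ : ∃ u v, w = ![u, v] := ⟨w 0, w 1, by ext1 i; fin_cases i <;> rfl⟩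
    set r₁ := (p - 1) * c₁ with hr₁
    set r₂ := (q - 1) * c₂ with hr₂
    -- Every term is a factor free of `b`, `b'` times a product of one form in `b` and one in `b'`,
    -- ready for the contraction rules.
    have hw : ∀ a a' b b' : V × W, weyl (modelMetric c₁ c₂) x ![u, a, v, b]
          * ricci (modelMetric c₁ c₂) x ![a', b']
        = (2 * A * fstForm c₁ x u v * r₁) * (fstForm c₁ x a b * fstForm c₁ x a' b')
          + (2 * A * fstForm c₁ x u v * r₂) * (fstForm c₁ x a b * sndForm c₂ x a' b')
          - (2 * A * fstForm c₁ x v a * r₁) * (fstForm c₁ x u b * fstForm c₁ x a' b')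
          - (2 * A * fstForm c₁ x v a * r₂) * (fstForm c₁ x u b * sndForm c₂ x a' b')
          + (2 * C * sndForm c₂ x u v * r₁) * (sndForm c₂ x a b * fstForm c₁ x a' b')
          + (2 * C * sndForm c₂ x u v * r₂) * (sndForm c₂ x a b * sndForm c₂ x a' b')
          - (2 * C * sndForm c₂ x v a * r₁) * (sndForm c₂ x u b * fstForm c₁ x a' b')
          - (2 * C * sndForm c₂ x v a * r₂) * (sndForm c₂ x u b * sndForm c₂ x a' b')
          + (B * fstForm c₁ x u v * r₁) * (sndForm c₂ x a b * fstForm c₁ x a' b')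
          + (B * fstForm c₁ x u v * r₂) * (sndForm c₂ x a b * sndForm c₂ x a' b')
          + (B * sndForm c₂ x u v * r₁) * (fstForm c₁ x a b * fstForm c₁ x a' b')
          + (B * sndForm c₂ x u v * r₂) * (fstForm c₁ x a b * sndForm c₂ x a' b')
          - (B * sndForm c₂ x v a * r₁) * (fstForm c₁ x u b * fstForm c₁ x a' b')
          - (B * sndForm c₂ x v a * r₂) * (fstForm c₁ x u b * sndForm c₂ x a' b')
          - (B * fstForm c₁ x v a * r₁) * (sndForm c₂ x u b * fstForm c₁ x a' b')
          - (B * fstForm c₁ x v a * r₂) * (sndForm c₂ x u b * sndForm c₂ x a' b') := by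
      intro a a' b b'
      rw [h, ricci_modelMetric h₁ h₂, ← hpdef, ← hqdef, ← hr₁, ← hr₂]
      simp only [Pi.add_apply, Pi.smul_apply, smul_eq_mul, kulkarniNomizu, fstTensor, sndTensor,
        Matrix.cons_val, fstForm_comm c₁ x a v, sndForm_comm c₂ x a v]
      ring
    have ht : ∀ a a' : V × W, metricTrace (modelMetric c₁ c₂) x
        (fun b b' => weyl (modelMetric c₁ c₂) x ![u, a, v, b]
          * ricci (modelMetric c₁ c₂) x ![a', b'])
        = (2 * A * fstForm c₁ x u v * r₁) * fstForm c₁ x a a'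
          - (2 * A * r₁) * (fstForm c₁ x v a * fstForm c₁ x u a')
          + (2 * C * sndForm c₂ x u v * r₂) * sndForm c₂ x a a'
          - (2 * C * r₂) * (sndForm c₂ x v a * sndForm c₂ x u a')
          + (B * fstForm c₁ x u v * r₂) * sndForm c₂ x a a'
          + (B * sndForm c₂ x u v * r₁) * fstForm c₁ x a a'
          - (B * r₁) * (sndForm c₂ x v a * fstForm c₁ x u a')
          - (B * r₂) * (fstForm c₁ x v a * sndForm c₂ x u a') := by
      intro a a'
      simp only [hw, metricTrace_add, metricTrace_sub, metricTrace_const_mul,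
        metricTrace_fstForm_mul_fstForm h₁ h₂, metricTrace_sndForm_mul_sndForm h₁ h₂,
        metricTrace_fstForm_mul_sndForm h₁ h₂, metricTrace_sndForm_mul_fstForm h₁ h₂]
      ring
    rw [bach, divSlot_eq_zero (covDeriv_weyl_modelMetric h₁ h₂ hV hW),
      divSlot_eq_zero (covDeriv_zero_left _), hfr, weylRicci]
    simp only [Matrix.cons_val, ht, metricTrace_add, metricTrace_sub, metricTrace_const_mul,
        metricTrace_fstForm_mul_fstForm h₁ h₂, metricTrace_sndForm_mul_sndForm h₁ h₂,
        metricTrace_fstForm_mul_sndForm h₁ h₂, metricTrace_sndForm_mul_fstForm h₁ h₂,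
        metricTrace_fstForm h₁ h₂, metricTrace_sndForm h₁ h₂, ← hpdef, ← hqdef, Pi.zero_apply,
        Pi.add_apply, Pi.smul_apply, smul_eq_mul, fstTensor, sndTensor, fstForm_comm c₁ x v u,
        sndForm_comm c₂ x v u]
    -- Trace-freeness replaces $Bq$ by $-2A(p-1)$.
    linear_combination 1 / (p + q - 2) * r₂ * fstForm c₁ x u v * hAB

lemma div2Bach_modelMetric (h₁ : 0 < c₁) (h₂ : 0 < c₂)
    (hV : 2 ≤ Module.finrank ℝ V) (hW : 2 ≤ Module.finrank ℝ W)
    (hne : ((Module.finrank ℝ V : ℝ) - 1) * c₁ ≠ ((Module.finrank ℝ W : ℝ) - 1) * c₂)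
    (x : V × W) :
    div2Bach (modelMetric c₁ c₂) x = 0 := by
  obtain ⟨α, β, -, h⟩ := exists_bach_modelMetric h₁ h₂ hV hW hne
  have h0 : covDeriv (modelMetric c₁ c₂) (bach (modelMetric (V := V) (W := W) c₁ c₂)) = 0 := by
    rw [h]
    exact (((isParallel_fstTensor h₁ h₂).const_smul α).add
      ((isParallel_sndTensor h₁ h₂).const_smul β)).covDeriv_eq_zero
  rw [div2Bach, divSlot_eq_zero h0, divSlot_eq_zero (covDeriv_zero_left _)]
  rfl

lemma bach_modelMetric_ne_zero (h₁ : 0 < c₁) (h₂ : 0 < c₂)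
    (hV : 2 ≤ Module.finrank ℝ V) (hW : 2 ≤ Module.finrank ℝ W)
    (hne : ((Module.finrank ℝ V : ℝ) - 1) * c₁ ≠ ((Module.finrank ℝ W : ℝ) - 1) * c₂)
    (x : V × W) : ∃ u : V × W, bach (modelMetric c₁ c₂) x ![u, u] ≠ 0 := by
  obtain ⟨α, β, hα, h⟩ := exists_bach_modelMetric h₁ h₂ hV hW hne
  have : Nontrivial V := Module.nontrivial_of_finrank_pos (R := ℝ) (by omega)
  obtain ⟨u, hu⟩ := exists_ne (0 : V)
  refine ⟨(u, 0), ?_⟩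
  rw [h]
  simp [fstTensor, sndTensor, fstForm, sndForm, hα, hu, (roundFactor_pos h₁ x.1).ne']

/-! ### Linear functions restricted to the sphere, in stereographic coordinates -/

lemma hessian_apply {E : Type*} [NormedAddCommGroup E] [NormedSpace ℝ E] (G : BilinField E)
    (f : E → ℝ) (x u v : E) :
    hessian G f x ![u, v]
      = fderiv ℝ (fun y => fderiv ℝ f y v) x u - fderiv ℝ f x (christoffel G x u v) := by
  have h : covDeriv G (k := 0) (fun x _ => f x) = fun y w => fderiv ℝ f y (w 0) := by
    funext y w
    simp [covDeriv]
  rw [hessian, h, covDeriv]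
  simp [Fin.tail]

/-- A function that is, in stereographic coordinates of the first factor, the restriction of a
linear function to the sphere. -/
lemma hessian_modelMetric (h₁ : 0 < c₁) (h₂ : 0 < c₂) (l : V →L[ℝ] ℝ) (t : ℝ) (u v : V × W) :
    hessian (modelMetric c₁ c₂)
        (fun y : V × W => (‖y.1‖ ^ 2 + 4)⁻¹ * (4 * l y.1 + (‖y.1‖ ^ 2 - 4) * t)) 0 ![u, v]
      = t * c₁ * fstForm c₁ 0 u v := by
  -- The only nonlinear ingredient left is `stereoFactor`.
  have hF : (fun y : V × W => (‖y.1‖ ^ 2 + 4)⁻¹ * (4 * l y.1 + (‖y.1‖ ^ 2 - 4) * t))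
      = fun y => t + stereoFactor y.1 * (2 * l y.1 - 4 * t) := by
    funext y
    have : ‖y.1‖ ^ 2 + 4 ≠ 0 := by positivity
    rw [stereoFactor]
    field_simp
    ring
  have hl : ∀ y : V × W, HasFDerivAt (fun y : V × W => 2 * l y.1 - 4 * t)
      ((2 : ℝ) • l.comp (ContinuousLinearMap.fst ℝ V W)) y := fun y =>
    (((l.comp (ContinuousLinearMap.fst ℝ V W)).hasFDerivAt).const_mul 2).sub_const _
  have hs : ∀ y : V × W, HasFDerivAt (fun y : V × W => stereoFactor y.1)
      ((-(stereoFactor y.1 ^ 2) • innerSL ℝ y.1).comp (ContinuousLinearMap.fst ℝ V W)) y :=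
    fun y => (hasFDerivAt_stereoFactor y.1).comp y hasFDerivAt_fst
  have hd : ∀ y : V × W, fderiv ℝ (fun y : V × W => t + stereoFactor y.1 * (2 * l y.1 - 4 * t)) y v
      = stereoFactor y.1 * (2 * l v.1)
        + (2 * l y.1 - 4 * t) * (-(stereoFactor y.1 ^ 2) * inner ℝ v.1 y.1) := fun y => by
    refine (DFunLike.congr_fun (((hs y).mul (hl y)).const_add t).fderiv v).trans ?_
    simp [real_inner_comm]
  have hi : HasFDerivAt (fun y : V × W => (inner ℝ v.1 y.1 : ℝ))
      ((innerSL ℝ v.1).comp (ContinuousLinearMap.fst ℝ V W)) 0 :=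
    ((innerSL ℝ v.1).comp (ContinuousLinearMap.fst ℝ V W)).hasFDerivAt
  have h2 := ((hs 0).mul_const (2 * l v.1)).add ((hl 0).mul (((hs 0).pow 2).neg.mul hi))
  have hfd : fderiv ℝ (fun y : V × W => stereoFactor y.1 * (2 * l v.1)
        + (2 * l y.1 - 4 * t) * (-(stereoFactor y.1 ^ 2) * inner ℝ v.1 y.1)) 0 u
      = t * inner ℝ u.1 v.1 := by
    refine (DFunLike.congr_fun h2.fderiv u).trans ?_
    simp [stereoFactor, real_inner_comm]
    ring
  -- At the centre the Hessian is the plain second derivative.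
  have hΓ : christoffel (modelMetric c₁ c₂) (0 : V × W) u v = 0 := by
    rw [christoffel_modelMetric h₁ h₂]
    ext1 <;> simp [roundGamma]
  rw [hessian_apply, hF, hΓ, map_zero]
  simp only [hd, hfd]
  simp [fstForm, roundFactor, stereoFactor]
  field_simp
  norm_num

/-- The vacuum static equations at the centre of the stereographic coordinates. -/
lemma vacuumStatic_modelMetric (h₁ : 0 < c₁) (h₂ : 0 < c₂)
    (hV : 2 ≤ Module.finrank ℝ V) (hW : 2 ≤ Module.finrank ℝ W)
    (hc : ((Module.finrank ℝ W : ℝ) - 1) * c₂ = Module.finrank ℝ V * c₁)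
    (l : V →L[ℝ] ℝ) (t : ℝ) {F : V × W → ℝ}
    (hF : F = fun y => (‖y.1‖ ^ 2 + 4)⁻¹ * (4 * l y.1 + (‖y.1‖ ^ 2 - 4) * t)) :
    laplacian (modelMetric c₁ c₂) F 0
        = -(scal (modelMetric c₁ c₂) (0 : V × W) / ((Module.finrank ℝ (V × W) : ℝ) - 1)) * -t ∧
      ∀ u v : V × W, hessian (modelMetric c₁ c₂) F 0 ![u, v]
        - (ricci (modelMetric c₁ c₂) 0 ![u, v] - scal (modelMetric c₁ c₂) (0 : V × W)
          / ((Module.finrank ℝ (V × W) : ℝ) - 1) * modelMetric c₁ c₂ 0 u v) * -t = 0 := by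
  have hs : scal (modelMetric c₁ c₂) (0 : V × W) / ((Module.finrank ℝ (V × W) : ℝ) - 1)
      = Module.finrank ℝ V * c₁ := by
    have hp : (2 : ℝ) ≤ Module.finrank ℝ V := by exact_mod_cast hV
    have hq : (2 : ℝ) ≤ Module.finrank ℝ W := by exact_mod_cast hW
    rw [scal_modelMetric h₁ h₂, Module.finrank_prod, mul_assoc (Module.finrank ℝ W : ℝ), hc]
    push_cast
    rw [div_eq_iff (by linarith)]
    ring
  rw [hs, hF]
  constructor
  · simp only [laplacian, hessian_modelMetric h₁ h₂, metricTrace_const_mul,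
      metricTrace_fstForm h₁ h₂]
    ring
  · intro u v
    rw [hessian_modelMetric h₁ h₂, ricci_modelMetric h₁ h₂, modelMetric_apply]
    -- The function has value `-t` at the centre. On the first factor $(p-1)c_1-pc_1=-c_1$ matches
    -- the Hessian; on the second, where the Hessian vanishes, the equation is exactly `hc`.
    linear_combination t * sndForm c₂ 0 u v * hc

end ModelCurvature

/-! ### Metrics induced by immersions -/

section Induced

/-- By compactness the form has a positive minimum $\mu$ on the unit sphere, so $\mu\|v\|^2\le
b(v,v)<1$. An empty unit sphere means that the space is zero. -/
lemma isVonNBounded_of_pos_def {E : Type*} [NormedAddCommGroup E] [NormedSpace ℝ E]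
    [FiniteDimensional ℝ E] (b : E →L[ℝ] E →L[ℝ] ℝ) (hb : ∀ v, v ≠ 0 → 0 < b v v) :
    Bornology.IsVonNBounded ℝ {v : E | b v v < 1} := by
  rw [NormedSpace.isVonNBounded_iff]
  have : ProperSpace E := FiniteDimensional.proper ℝ E
  have hcont : Continuous fun v : E => b v v := by fun_prop
  obtain hS | hS := (Metric.sphere (0 : E) 1).eq_empty_or_nonempty
  · have hE : ∀ v : E, v = 0 := by
      intro v
      by_contra hv
      have : ‖v‖⁻¹ • v ∈ Metric.sphere (0 : E) 1 := by
        simp [norm_smul, hv]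
      simp [hS] at this
    refine (Bornology.isBounded_singleton (x := (0 : E))).subset fun v _ => hE v
  · obtain ⟨w, hw, hmin⟩ := (isCompact_sphere (0 : E) 1).exists_isMinOn hS hcont.continuousOn
    have hw0 : w ≠ 0 := by
      rintro rfl
      simp at hw
    have hm := hb w hw0
    refine (Metric.isBounded_closedBall (x := (0 : E)) (r := √(b w w)⁻¹)).subset fun v hv => ?_
    rw [mem_closedBall_zero_iff]
    by_cases hv0 : v = 0
    · simp [hv0]
    apply Real.le_sqrt_of_sq_le
    have hn : 0 < ‖v‖ := norm_pos_iff.2 hv0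
    have h1 : b w w ≤ b (‖v‖⁻¹ • v) (‖v‖⁻¹ • v) :=
      hmin (show ‖v‖⁻¹ • v ∈ Metric.sphere (0 : E) 1 by simp [norm_smul, hv0])
    have hv' : b v v < 1 := hv
    simp only [map_smul, smul_apply, smul_eq_mul] at h1
    have h2 : b w w * ‖v‖ ^ 2 ≤ b v v := by
      calc b w w * ‖v‖ ^ 2 ≤ (‖v‖⁻¹ * (‖v‖⁻¹ * b v v)) * ‖v‖ ^ 2 := by gcongr
        _ = b v v := by field_simp
    rw [← one_div, le_div_iff₀ hm]
    linarith

variable {E : Type*} [NormedAddCommGroup E] [NormedSpace ℝ E] [FiniteDimensional ℝ E]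
  {H : Type*} [TopologicalSpace H] {I : ModelWithCorners ℝ E H}
  {M : Type*} [TopologicalSpace M] [ChartedSpace H M] [IsManifold I ∞ M]
  {F : Type*} [NormedAddCommGroup F] [NormedSpace ℝ F]

variable (I) in
/-- The pullback of a constant bilinear form by a map to a vector space. -/
def pullbackForm (Φ : M → F) (b : F →L[ℝ] F →L[ℝ] ℝ) (x : M) :
    TangentSpace I x →L[ℝ] TangentSpace I x →L[ℝ] ℝ :=
  ContinuousLinearMap.bilinearComp (E := F) (F := F) (E' := E) (F' := E) b (mfderiv I 𝓘(ℝ, F) Φ x)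
    (mfderiv I 𝓘(ℝ, F) Φ x)

/-- In the trivialization at `x₀` the form is `b.bilinearComp D D`, where `D` is the derivative of
`Φ` in tangent coordinates. It depends smoothly on the point, and the expression is quadratic in
`D`. -/
lemma contMDiff_pullbackForm {Φ : M → F} (hΦ : ContMDiff I 𝓘(ℝ, F) ∞ Φ)
    (b : F →L[ℝ] F →L[ℝ] ℝ) :
    ContMDiff I (I.prod 𝓘(ℝ, E →L[ℝ] E →L[ℝ] ℝ)) ∞
      (fun x : M => Bundle.TotalSpace.mk' (E →L[ℝ] E →L[ℝ] ℝ)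
        (E := fun x => TangentSpace I x →L[ℝ] TangentSpace I x →L[ℝ] ℝ) x
        (pullbackForm I Φ b x)) := by
  intro x₀
  rw [Bundle.contMDiffAt_section]
  have hD : ContMDiffAt I 𝓘(ℝ, E →L[ℝ] F) ∞
      (inTangentCoordinates I 𝓘(ℝ, F) id Φ (fun x => mfderiv I 𝓘(ℝ, F) Φ x) x₀) x₀ :=
    (hΦ x₀).mfderiv_const (m := ∞) (by simp)
  have hB : ContMDiffAt I 𝓘(ℝ, E →L[ℝ] E →L[ℝ] ℝ) ∞
      (fun x => b.bilinearComp
        (inTangentCoordinates I 𝓘(ℝ, F) id Φ (fun x => mfderiv I 𝓘(ℝ, F) Φ x) x₀ x)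
        (inTangentCoordinates I 𝓘(ℝ, F) id Φ (fun x => mfderiv I 𝓘(ℝ, F) Φ x) x₀ x)) x₀ := by
    have hcd : ContDiff ℝ ∞ fun D : E →L[ℝ] F => b.bilinearComp D D := by
      rw [contDiff_clm_apply_iff]
      intro u
      rw [contDiff_clm_apply_iff]
      intro v
      exact (b.contDiff.comp (contDiff_id.clm_apply contDiff_const)).clm_apply
        (contDiff_id.clm_apply contDiff_const)
    exact hcd.contDiffAt.contMDiffAt.comp x₀ hD
  refine hB.congr_of_eventuallyEq ?_
  filter_upwards [(chartAt H x₀).open_source.mem_nhds (mem_chart_source H x₀)] with x hx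
  ext v w
  simp [hom_trivializationAt_apply, ContinuousLinearMap.inCoordinates, inTangentCoordinates,
    pullbackForm]
  have hx' : x ∈ (trivializationAt (E →L[ℝ] ℝ) (fun x => TangentSpace I x →L[ℝ] ℝ) x₀).baseSet :=
      by
    simp [hom_trivializationAt_baseSet, hx]
  rw [Bundle.Trivialization.linearMapAt_apply, if_pos hx', hom_trivializationAt_apply]
  simp [ContinuousLinearMap.inCoordinates]
  rfl

/-- The Riemannian metric induced by an immersion. -/
def inducedMetric {Φ : M → F} (hΦ : ContMDiff I 𝓘(ℝ, F) ∞ Φ)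
    (hinj : ∀ x, Function.Injective (mfderiv I 𝓘(ℝ, F) Φ x))
    (b : F →L[ℝ] F →L[ℝ] ℝ) (hs : ∀ u v, b u v = b v u) (hpos : ∀ v, v ≠ 0 → 0 < b v v) :
    RMetric I M where
  inner x := pullbackForm I Φ b x
  symm x u v := hs (mfderiv I 𝓘(ℝ, F) Φ x u) (mfderiv I 𝓘(ℝ, F) Φ x v)
  pos x v hv := hpos (mfderiv I 𝓘(ℝ, F) Φ x v) fun h => hv (hinj x (h.trans (map_zero _).symm))
  isVonNBounded x := isVonNBounded_of_pos_def (E := E) (pullbackForm I Φ b x) fun v hv =>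
    hpos (mfderiv I 𝓘(ℝ, F) Φ x v) fun h => hv (hinj x (h.trans (map_zero _).symm))
  contMDiff := contMDiff_pullbackForm hΦ b

end Induced

/-! ### Completeness of compact manifolds -/

section Complete

variable {E : Type*} [NormedAddCommGroup E] [NormedSpace ℝ E]
  {H : Type*} [TopologicalSpace H] {I : ModelWithCorners ℝ E H}
  {M : Type*} [TopologicalSpace M] [ChartedSpace H M] [IsManifold I ∞ M]

/-- The Riemannian distance induces the given topology, so compactness makes every Cauchy sequence
converge in it. -/
lemma isComplete_of_compactSpace [CompactSpace M] [T2Space M] (g : RMetric I M) :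
    IsComplete g := by
  let _ : Bundle.RiemannianBundle (fun x : M => TangentSpace I x) := ⟨g.toRiemannianMetric⟩
  have : IsManifold I 1 M := IsManifold.of_le (n := ∞) (by simp)
  have : IsContinuousRiemannianBundle E (fun x : M => TangentSpace I x) :=
    ⟨g.inner, g.contMDiff.continuous, fun _ _ _ => rfl⟩
  let _ : PseudoEMetricSpace M := PseudoEMetricSpace.ofRiemannianMetric I M
  intro u hu
  have hc : CauchySeq u := EMetric.cauchySeq_iff.2 fun ε hε => hu ε hε
  exact cauchySeq_tendsto_of_complete hc

end Complete

/-! ### Inverse stereographic projection -/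

section Stereo

variable {V F : Type*} [NormedAddCommGroup V] [InnerProductSpace ℝ V]
  [NormedAddCommGroup F] [InnerProductSpace ℝ F]

/-- The inverse stereographic projection with pole `v`, where `J` parametrizes the orthogonal
complement of `v`. -/
def stereoParam (J : V →ₗᵢ[ℝ] F) (v : F) (y : V) : F :=
  (‖y‖ ^ 2 + 4)⁻¹ • ((4 : ℝ) • J y + (‖y‖ ^ 2 - 4) • v)

lemma hasFDerivAt_stereoParam (J : V →ₗᵢ[ℝ] F) (v : F) (y : V) :
    HasFDerivAt (stereoParam J v)
      ((2 * stereoFactor y) • J.toContinuousLinearMap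
        - (stereoFactor y ^ 2 • innerSL ℝ y).smulRight ((2 : ℝ) • J y - (4 : ℝ) • v)) y := by
  have hF : stereoParam J v = fun y => v + stereoFactor y • ((2 : ℝ) • J y - (4 : ℝ) • v) := by
    funext y
    have : ‖y‖ ^ 2 + 4 ≠ 0 := by positivity
    rw [stereoParam, stereoFactor]
    match_scalars <;> field_simp <;> ring
  have hJ : HasFDerivAt (fun y => (2 : ℝ) • J y - (4 : ℝ) • v)
      ((2 : ℝ) • J.toContinuousLinearMap) y :=
    ((J.toContinuousLinearMap.hasFDerivAt).const_smul (2 : ℝ)).sub_const _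
  rw [hF]
  refine (((hasFDerivAt_stereoFactor y).smul hJ).const_add v).congr_fderiv ?_
  ext u
  simp
  module

/-- Inverse stereographic projection is conformal. -/
lemma inner_fderiv_stereoParam {J : V →ₗᵢ[ℝ] F} {v : F} (hv : ‖v‖ = 1)
    (hJ : ∀ y, inner ℝ (J y) v = 0) (y u w : V) :
    inner ℝ (fderiv ℝ (stereoParam J v) y u) (fderiv ℝ (stereoParam J v) y w)
      = 4 * stereoFactor y ^ 2 * inner ℝ u w := by
  have h := stereoFactor_mul_inner_self y
  have hv' : inner ℝ v v = (1 : ℝ) := by rw [real_inner_self_eq_norm_sq, hv]; norm_num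
  have hJ' : ∀ y, inner ℝ v (J y) = 0 := fun y => by rw [real_inner_comm, hJ]
  rw [(hasFDerivAt_stereoParam J v y).fderiv]
  simp only [sub_apply, smul_apply, ContinuousLinearMap.smulRight_apply, innerSL_apply_apply,
    LinearIsometry.coe_toContinuousLinearMap, inner_sub_left, inner_sub_right, inner_smul_left,
    inner_smul_right, RCLike.conj_to_real, LinearIsometry.inner_map_map, hJ, hJ', hv', smul_eq_mul,
    real_inner_comm y u]
  linear_combination (4 * stereoFactor y ^ 3 * inner ℝ y u * inner ℝ y w) * h

end Stereo

/-! ### Preferred charts of the unit spheres and the product metric -/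

section Sphere

variable {p q : ℕ}

lemma extChartAt_sphere_self (x : Sph p) : extChartAt (𝓡 p) x x = 0 := by
  have : Fact (Module.finrank ℝ (EuclideanSpace ℝ (Fin (p + 1))) = p + 1) :=
    ⟨finrank_euclideanSpace_fin⟩
  change (OrthonormalBasis.fromOrthogonalSpanSingleton p (ne_zero_of_mem_unit_sphere (-x))).repr
    (stereographic (norm_eq_of_mem_sphere (-x)) x) = 0
  rw [stereographic_neg_apply, map_zero]

/-- The chart at `x` projects from `-x` and then applies an orthonormal basis of the complement of
`-x`. Only the resulting isometric embedding `J` is kept, since the choice of basis does not affect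
the metric. -/
lemma exists_extChartAt_sphere_symm (x : Sph p) :
    ∃ J : EuclideanSpace ℝ (Fin p) →ₗᵢ[ℝ] EuclideanSpace ℝ (Fin (p + 1)),
      (∀ y, inner ℝ (J y) (-(x : EuclideanSpace ℝ (Fin (p + 1)))) = 0) ∧
      ∀ y, ((extChartAt (𝓡 p) x).symm y : EuclideanSpace ℝ (Fin (p + 1)))
        = stereoParam J (-(x : EuclideanSpace ℝ (Fin (p + 1)))) y := by
  have : Fact (Module.finrank ℝ (EuclideanSpace ℝ (Fin (p + 1))) = p + 1) :=
    ⟨finrank_euclideanSpace_fin⟩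
  let U := (OrthonormalBasis.fromOrthogonalSpanSingleton (𝕜 := ℝ) p
    (ne_zero_of_mem_unit_sphere (-x))).repr
  let J := (Submodule.subtypeₗᵢ _).comp U.symm.toLinearIsometry
  have hJ : ∀ y, J y = (U.symm y : EuclideanSpace ℝ (Fin (p + 1))) := fun _ => rfl
  refine ⟨J, fun y => ?_, fun y => ?_⟩
  · have h := (U.symm y).2
    rw [Submodule.mem_orthogonal_singleton_iff_inner_left] at h
    exact h
  · refine (stereographic'_symm_apply (-x) y).trans ?_
    have hn : ‖(U.symm y : EuclideanSpace ℝ (Fin (p + 1)))‖ = ‖y‖ := J.norm_map y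
    change (‖(U.symm y : EuclideanSpace ℝ (Fin (p + 1)))‖ ^ 2 + 4)⁻¹ • (4 : ℝ) •
        (U.symm y : EuclideanSpace ℝ (Fin (p + 1)))
      + (‖(U.symm y : EuclideanSpace ℝ (Fin (p + 1)))‖ ^ 2 + 4)⁻¹ •
        (‖(U.symm y : EuclideanSpace ℝ (Fin (p + 1)))‖ ^ 2 - 4) •
          (-x : EuclideanSpace ℝ (Fin (p + 1))) = _
    rw [hn, stereoParam, smul_add, hJ]

/-- Because of this the chart metric can be identified with the model on the whole space, with no
restriction to neighbourhoods when differentiating. -/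
lemma extChartAt_sphere_target (x : Sph p) : (extChartAt (𝓡 p) x).target = Set.univ := by
  have : Fact (Module.finrank ℝ (EuclideanSpace ℝ (Fin (p + 1))) = p + 1) :=
    ⟨finrank_euclideanSpace_fin⟩
  rw [extChartAt_target]
  have h : (chartAt (EuclideanSpace ℝ (Fin p)) x).target = Set.univ := stereographic'_target (-x)
  simp [h]

lemma contMDiff_sphere_coe :
    ContMDiff (𝓡 p) 𝓘(ℝ, EuclideanSpace ℝ (Fin (p + 1))) ∞
      (fun z : Sph p => (z : EuclideanSpace ℝ (Fin (p + 1)))) := by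
  have : Fact (Module.finrank ℝ (EuclideanSpace ℝ (Fin (p + 1))) = p + 1) :=
    ⟨finrank_euclideanSpace_fin⟩
  exact contMDiff_coe_sphere

lemma ambientVec_injective (x : Sph p) : Function.Injective (ambientVec x) := by
  have : Fact (Module.finrank ℝ (EuclideanSpace ℝ (Fin (p + 1))) = p + 1) :=
    ⟨finrank_euclideanSpace_fin⟩
  exact injective_mvfderiv_subtypeVal_sphere x

/-- The inclusion of a product of unit spheres in the product of the ambient spaces. -/
def spheresIncl (z : Sph p × Sph q) :
    EuclideanSpace ℝ (Fin (p + 1)) × EuclideanSpace ℝ (Fin (q + 1)) := (z.1, z.2)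

lemma contMDiff_spheresIncl :
    ContMDiff ((𝓡 p).prod (𝓡 q))
      𝓘(ℝ, EuclideanSpace ℝ (Fin (p + 1)) × EuclideanSpace ℝ (Fin (q + 1))) ∞
      (spheresIncl (p := p) (q := q)) :=
  (contMDiff_sphere_coe.comp contMDiff_fst).prodMk_space
    (contMDiff_sphere_coe.comp contMDiff_snd)

lemma mfderiv_spheresIncl (x : Sph p × Sph q) (u : TangentSpace ((𝓡 p).prod (𝓡 q)) x) :
    mfderiv ((𝓡 p).prod (𝓡 q))
      𝓘(ℝ, EuclideanSpace ℝ (Fin (p + 1)) × EuclideanSpace ℝ (Fin (q + 1))) spheresIncl x u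
      = (ambientVec x.1 (Prod.fst u), ambientVec x.2 (Prod.snd u)) := by
  have h1 : MDifferentiableAt (𝓡 p) 𝓘(ℝ, EuclideanSpace ℝ (Fin (p + 1)))
      (fun z : Sph p => (z : EuclideanSpace ℝ (Fin (p + 1)))) x.1 :=
    contMDiff_sphere_coe.mdifferentiableAt (by simp)
  have h2 : MDifferentiableAt (𝓡 q) 𝓘(ℝ, EuclideanSpace ℝ (Fin (q + 1)))
      (fun z : Sph q => (z : EuclideanSpace ℝ (Fin (q + 1)))) x.2 :=
    contMDiff_sphere_coe.mdifferentiableAt (by simp)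
  have h := mfderiv_prodMap h1 h2
  -- The product map lands in a product of manifolds; its structure is identified with that of the
  -- product normed space.
  rw [← modelWithCornersSelf_prod, chartedSpaceSelf_prod] at h
  exact DFunLike.congr_fun h u

/-- The bilinear form on the ambient space inducing the product metric. -/
def ambientForm (p q : ℕ) (c₁ c₂ : ℝ) :
    (EuclideanSpace ℝ (Fin (p + 1)) × EuclideanSpace ℝ (Fin (q + 1))) →L[ℝ]
      (EuclideanSpace ℝ (Fin (p + 1)) × EuclideanSpace ℝ (Fin (q + 1))) →L[ℝ] ℝ :=
  (1 / c₁) • fstInner _ _ + (1 / c₂) • sndInner _ _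

lemma ambientForm_apply (c₁ c₂ : ℝ)
    (u v : EuclideanSpace ℝ (Fin (p + 1)) × EuclideanSpace ℝ (Fin (q + 1))) :
    ambientForm p q c₁ c₂ u v = 1 / c₁ * inner ℝ u.1 v.1 + 1 / c₂ * inner ℝ u.2 v.2 := rfl

lemma ambientForm_pos {c₁ c₂ : ℝ} (h₁ : 0 < c₁) (h₂ : 0 < c₂)
    (v : EuclideanSpace ℝ (Fin (p + 1)) × EuclideanSpace ℝ (Fin (q + 1))) (hv : v ≠ 0) :
    0 < ambientForm p q c₁ c₂ v v := by
  rw [ambientForm_apply, real_inner_self_eq_norm_sq, real_inner_self_eq_norm_sq]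
  by_cases h : v.1 = 0
  · have h' : v.2 ≠ 0 := fun h' => hv (Prod.ext h h')
    have := norm_pos_iff.2 h'
    positivity
  · have := norm_pos_iff.2 h
    positivity

/-- The product metric on `S^p(c₁) × S^q(c₂)`. -/
def roundProduct (p q : ℕ) {c₁ c₂ : ℝ} (h₁ : 0 < c₁) (h₂ : 0 < c₂) :
    RMetric ((𝓡 p).prod (𝓡 q)) (Sph p × Sph q) :=
  inducedMetric contMDiff_spheresIncl
    (fun x u v h => by
      rw [mfderiv_spheresIncl, mfderiv_spheresIncl] at h
      exact Prod.ext (ambientVec_injective x.1 (congrArg Prod.fst h))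
        (ambientVec_injective x.2 (congrArg Prod.snd h)))
    (ambientForm p q c₁ c₂)
    (fun u v => by
      rw [ambientForm_apply, ambientForm_apply, real_inner_comm, real_inner_comm u.2])
    (ambientForm_pos h₁ h₂)

lemma isRoundProduct_roundProduct {c₁ c₂ : ℝ} (h₁ : 0 < c₁) (h₂ : 0 < c₂) :
    IsRoundProduct c₁ c₂ (roundProduct p q h₁ h₂) := by
  intro x u v
  change ambientForm p q c₁ c₂ (mfderiv _ _ spheresIncl x u) (mfderiv _ _ spheresIncl x v) = _
  rw [mfderiv_spheresIncl, mfderiv_spheresIncl]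
  rfl

lemma extChartAt_spheres_self (x : Sph p × Sph q) :
    extChartAt ((𝓡 p).prod (𝓡 q)) x x = 0 := by
  rw [extChartAt_prod]
  exact Prod.ext (extChartAt_sphere_self x.1) (extChartAt_sphere_self x.2)

/-- The inclusion after the inverse chart is a pair of maps `stereoParam`, each conformal with
factor `4 * stereoFactor ^ 2`; division by the curvature gives `roundFactor`. -/
lemma chartMetric_roundProduct {c₁ c₂ : ℝ} (h₁ : 0 < c₁) (h₂ : 0 < c₂) (x : Sph p × Sph q) :
    chartMetric (roundProduct p q h₁ h₂) x = modelMetric c₁ c₂ := by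
  obtain ⟨J₁, hJ₁, e₁⟩ := exists_extChartAt_sphere_symm x.1
  obtain ⟨J₂, hJ₂, e₂⟩ := exists_extChartAt_sphere_symm x.2
  have n₁ : ‖-(x.1 : EuclideanSpace ℝ (Fin (p + 1)))‖ = 1 := by simp
  have n₂ : ‖-(x.2 : EuclideanSpace ℝ (Fin (q + 1)))‖ = 1 := by simp
  funext y
  refine ContinuousLinearMap.ext fun u => ContinuousLinearMap.ext fun v => ?_
  have hσ : MDifferentiableAt
      𝓘(ℝ, EuclideanSpace ℝ (Fin p) × EuclideanSpace ℝ (Fin q)) ((𝓡 p).prod (𝓡 q))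
      (extChartAt ((𝓡 p).prod (𝓡 q)) x).symm y := by
    have := mdifferentiableWithinAt_extChartAt_symm (I := (𝓡 p).prod (𝓡 q)) (x := x) (z := y)
      (by
        rw [extChartAt_prod, PartialEquiv.prod_target, extChartAt_sphere_target,
          extChartAt_sphere_target, Set.univ_prod_univ]
        trivial)
    rwa [ModelWithCorners.range_eq_univ, mdifferentiableWithinAt_univ] at this
  have hΦ : MDifferentiableAt ((𝓡 p).prod (𝓡 q))
      𝓘(ℝ, EuclideanSpace ℝ (Fin (p + 1)) × EuclideanSpace ℝ (Fin (q + 1))) spheresIncl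
      ((extChartAt ((𝓡 p).prod (𝓡 q)) x).symm y) :=
    contMDiff_spheresIncl.mdifferentiableAt (by simp)
  have hcomp : spheresIncl ∘ (extChartAt ((𝓡 p).prod (𝓡 q)) x).symm
      = fun y => (stereoParam J₁ (-(x.1 : EuclideanSpace ℝ (Fin (p + 1)))) y.1,
        stereoParam J₂ (-(x.2 : EuclideanSpace ℝ (Fin (q + 1)))) y.2) := by
    funext y
    rw [extChartAt_prod]
    exact Prod.ext (e₁ y.1) (e₂ y.2)
  have hd : ∀ u : EuclideanSpace ℝ (Fin p) × EuclideanSpace ℝ (Fin q),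
      mfderiv ((𝓡 p).prod (𝓡 q))
        𝓘(ℝ, EuclideanSpace ℝ (Fin (p + 1)) × EuclideanSpace ℝ (Fin (q + 1))) spheresIncl
        ((extChartAt ((𝓡 p).prod (𝓡 q)) x).symm y)
        (mfderiv 𝓘(ℝ, EuclideanSpace ℝ (Fin p) × EuclideanSpace ℝ (Fin q)) ((𝓡 p).prod (𝓡 q))
          (extChartAt ((𝓡 p).prod (𝓡 q)) x).symm y u)
        = (fderiv ℝ (stereoParam J₁ (-(x.1 : EuclideanSpace ℝ (Fin (p + 1))))) y.1 u.1,
          fderiv ℝ (stereoParam J₂ (-(x.2 : EuclideanSpace ℝ (Fin (q + 1))))) y.2 u.2) := by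
    intro u
    have h := DFunLike.congr_fun (mfderiv_comp y hΦ hσ) u
    refine h.symm.trans ?_
    rw [hcomp, mfderiv_eq_fderiv]
    have h' := (((hasFDerivAt_stereoParam J₁ (-(x.1 : EuclideanSpace ℝ (Fin (p + 1))))
        y.1).differentiableAt.hasFDerivAt.comp y (hasFDerivAt_fst (𝕜 := ℝ) (p := y))).prodMk
      ((hasFDerivAt_stereoParam J₂ (-(x.2 : EuclideanSpace ℝ (Fin (q + 1))))
        y.2).differentiableAt.hasFDerivAt.comp y (hasFDerivAt_snd (𝕜 := ℝ) (p := y)))).fderiv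
    exact DFunLike.congr_fun h' u
  change ambientForm p q c₁ c₂
    (mfderiv ((𝓡 p).prod (𝓡 q))
        𝓘(ℝ, EuclideanSpace ℝ (Fin (p + 1)) × EuclideanSpace ℝ (Fin (q + 1))) spheresIncl
        ((extChartAt ((𝓡 p).prod (𝓡 q)) x).symm y)
        (mfderiv 𝓘(ℝ, EuclideanSpace ℝ (Fin p) × EuclideanSpace ℝ (Fin q)) ((𝓡 p).prod (𝓡 q))
          (extChartAt ((𝓡 p).prod (𝓡 q)) x).symm y u))
    (mfderiv ((𝓡 p).prod (𝓡 q))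
        𝓘(ℝ, EuclideanSpace ℝ (Fin (p + 1)) × EuclideanSpace ℝ (Fin (q + 1))) spheresIncl
        ((extChartAt ((𝓡 p).prod (𝓡 q)) x).symm y)
        (mfderiv 𝓘(ℝ, EuclideanSpace ℝ (Fin p) × EuclideanSpace ℝ (Fin q)) ((𝓡 p).prod (𝓡 q))
          (extChartAt ((𝓡 p).prod (𝓡 q)) x).symm y v)) = _
  rw [hd u, hd v, ambientForm_apply, inner_fderiv_stereoParam n₁ hJ₁,
    inner_fderiv_stereoParam n₂ hJ₂, modelMetric_apply, fstForm, sndForm, roundFactor, roundFactor]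
  ring

end Sphere

/-! ### Vacuum static products of spheres -/

section Example

variable {p q : ℕ} {c₁ c₂ : ℝ}

lemma solvesVacuumStatic_roundProduct (h₁ : 0 < c₁) (h₂ : 0 < c₂) (hp : 2 ≤ p) (hq : 2 ≤ q)
    (hc : ((q : ℝ) - 1) * c₂ = p * c₁) (e : EuclideanSpace ℝ (Fin (p + 1))) :
    SolvesVacuumStatic (roundProduct p q h₁ h₂)
      (fun z => inner ℝ (z.1 : EuclideanSpace ℝ (Fin (p + 1))) e) := by
  intro x
  obtain ⟨J, hJ, hx⟩ := exists_extChartAt_sphere_symm x.1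
  -- Since the pole is `-x.1`, the parameter `t` of the model is `-⟨x.1, e⟩`.
  have hF : (fun z : Sph p × Sph q => (inner ℝ (z.1 : EuclideanSpace ℝ (Fin (p + 1))) e : ℝ))
        ∘ (extChartAt ((𝓡 p).prod (𝓡 q)) x).symm
      = fun y => (‖y.1‖ ^ 2 + 4)⁻¹ * (4 * ((innerSL ℝ e).comp J.toContinuousLinearMap) y.1
          + (‖y.1‖ ^ 2 - 4) * -inner ℝ (x.1 : EuclideanSpace ℝ (Fin (p + 1))) e) := by
    funext y
    have h : ((((extChartAt ((𝓡 p).prod (𝓡 q)) x).symm y).1 : Sph p) :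
        EuclideanSpace ℝ (Fin (p + 1)))
        = stereoParam J (-(x.1 : EuclideanSpace ℝ (Fin (p + 1)))) y.1 := by
      rw [extChartAt_prod]
      exact hx y.1
    simp only [Function.comp_apply, h, stereoParam, inner_smul_right, inner_add_right,
      inner_neg_right, ContinuousLinearMap.comp_apply, innerSL_apply_apply,
      LinearIsometry.coe_toContinuousLinearMap, real_inner_comm e]
  have hd : ∀ k : ℕ, Module.finrank ℝ (EuclideanSpace ℝ (Fin k)) = k := fun k =>
    finrank_euclideanSpace_fin
  have h := vacuumStatic_modelMetric (V := EuclideanSpace ℝ (Fin p))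
    (W := EuclideanSpace ℝ (Fin q)) h₁ h₂ (by rwa [hd]) (by rwa [hd])
    (by rwa [hd, hd]) _ _ hF
  rw [neg_neg] at h
  intro G F y n
  simp only [G, F, y, chartMetric_roundProduct, extChartAt_spheres_self]
  exact h

lemma isExample_roundProduct (h₁ : 0 < c₁) (h₂ : 0 < c₂) (hp : 2 ≤ p) (hq : 2 ≤ q)
    (hc : ((q : ℝ) - 1) * c₂ = p * c₁) : IsExample (roundProduct p q h₁ h₂) := by
  have hd : ∀ k : ℕ, Module.finrank ℝ (EuclideanSpace ℝ (Fin k)) = k := fun k =>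
    finrank_euclideanSpace_fin
  have hV : 2 ≤ Module.finrank ℝ (EuclideanSpace ℝ (Fin p)) := by rwa [hd]
  have hW : 2 ≤ Module.finrank ℝ (EuclideanSpace ℝ (Fin q)) := by rwa [hd]
  -- Under the static relation, equality would read $(p-1)c_1=pc_1$, against $c_1>0$.
  have hne : ((Module.finrank ℝ (EuclideanSpace ℝ (Fin p)) : ℝ) - 1) * c₁
      ≠ ((Module.finrank ℝ (EuclideanSpace ℝ (Fin q)) : ℝ) - 1) * c₂ := by
    rw [hd, hd, hc]
    intro h
    linarith
  obtain ⟨z⟩ : Nonempty (Sph q) := (NormedSpace.sphere_nonempty.2 zero_le_one).to_subtype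
  obtain ⟨w⟩ : Nonempty (Sph p) := (NormedSpace.sphere_nonempty.2 zero_le_one).to_subtype
  -- Pairing with the unit vector `w` gives a function equal to 1 at `(w, z)`.
  refine ⟨⟨isComplete_of_compactSpace _, fun z => inner ℝ (z.1 : EuclideanSpace ℝ (Fin (p + 1)))
    (w : EuclideanSpace ℝ (Fin (p + 1))), ?_, ⟨(w, z), ?_⟩,
    solvesVacuumStatic_roundProduct h₁ h₂ hp hq hc _⟩, ?_, ?_, ?_⟩
  · have h : ContMDiff ((𝓡 p).prod (𝓡 q)) 𝓘(ℝ, EuclideanSpace ℝ (Fin (p + 1))) ∞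
        (fun z : Sph p × Sph q => (z.1 : EuclideanSpace ℝ (Fin (p + 1)))) :=
      contMDiff_sphere_coe.comp contMDiff_fst
    have h' : ContDiff ℝ ∞ fun v : EuclideanSpace ℝ (Fin (p + 1)) =>
        (inner ℝ v (w : EuclideanSpace ℝ (Fin (p + 1))) : ℝ) := contDiff_id.inner ℝ contDiff_const
    exact h'.contMDiff.comp h
  · simp
  · intro x
    rw [chartMetric_roundProduct]
    exact div2Bach_modelMetric h₁ h₂ hV hW hne _
  · intro x
    rw [chartMetric_roundProduct]
    exact div4Weyl_modelMetric h₁ h₂ hV hW _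
  · intro h
    obtain ⟨u, hu⟩ := bach_modelMetric_ne_zero h₁ h₂ hV hW hne
      (extChartAt ((𝓡 p).prod (𝓡 q)) (w, z) (w, z))
    have h' : bach (chartMetric (roundProduct p q h₁ h₂) (w, z))
        (extChartAt ((𝓡 p).prod (𝓡 q)) (w, z) (w, z)) ![u, u] = 0 := h (w, z) u u
    rw [chartMetric_roundProduct] at h'
    exact hu h'

lemma exists_isExample_roundProduct (hp : 2 ≤ p) (hq : 2 ≤ q) (h₁ : 0 < c₁) (h₂ : 0 < c₂)
    (hc : ((q : ℝ) - 1) * c₂ = p * c₁) :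
    ∃ g : RMetric ((𝓡 p).prod (𝓡 q)) (Sph p × Sph q), IsRoundProduct c₁ c₂ g ∧ IsExample g :=
  ⟨roundProduct p q h₁ h₂, isRoundProduct_roundProduct h₁ h₂,
    isExample_roundProduct h₁ h₂ hp hq hc⟩

lemma connectedSpace_sph (hp : 1 ≤ p) : ConnectedSpace (Sph p) := by
  rw [← isConnected_iff_connectedSpace]
  refine isConnected_sphere ?_ _ zero_le_one
  rw [← Module.finrank_eq_rank, finrank_euclideanSpace_fin]
  exact_mod_cast (by omega : 1 < p + 1)

lemma exists_example_of_finrank_add (hp : 2 ≤ p) (hq : 2 ≤ q) (h₁ : 0 < c₁) (h₂ : 0 < c₂)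
    (hc : ((q : ℝ) - 1) * c₂ = p * c₁) :
    ∃ (E : Type) (_ : NormedAddCommGroup E) (_ : NormedSpace ℝ E) (_ : FiniteDimensional ℝ E)
      (H : Type) (_ : TopologicalSpace H) (I : ModelWithCorners ℝ E H)
      (M : Type) (_ : TopologicalSpace M) (_ : ChartedSpace H M) (_ : IsManifold I ∞ M)
      (g : RMetric I M),
      I.Boundaryless ∧ T2Space M ∧ SecondCountableTopology M ∧ ConnectedSpace M ∧
        Module.finrank ℝ E = p + q ∧ IsExample g := by
  have := connectedSpace_sph (p := p) (by omega)
  have := connectedSpace_sph (p := q) (by omega)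
  refine ⟨_, _, _, inferInstance, _, _, (𝓡 p).prod (𝓡 q), Sph p × Sph q, _, _, _,
    roundProduct p q h₁ h₂, inferInstance, inferInstance, inferInstance, inferInstance, ?_,
    isExample_roundProduct h₁ h₂ hp hq hc⟩
  rw [Module.finrank_prod, finrank_euclideanSpace_fin, finrank_euclideanSpace_fin]

end Example

end StaticSpace

end

theorem proposition2p5 :
    -- existence in every dimension `n ≥ 4`
    (∀ n : ℕ, 4 ≤ n →
      ∃ (E : Type) (_ : NormedAddCommGroup E) (_ : NormedSpace ℝ E) (_ : FiniteDimensional ℝ E)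
        (H : Type) (_ : TopologicalSpace H) (I : ModelWithCorners ℝ E H)
        (M : Type) (_ : TopologicalSpace M) (_ : ChartedSpace H M) (_ : IsManifold I ∞ M)
        (g : StaticSpace.RMetric I M),
        I.Boundaryless ∧ T2Space M ∧ SecondCountableTopology M ∧ ConnectedSpace M ∧
          Module.finrank ℝ E = n ∧ StaticSpace.IsExample g) ∧
    -- dimension `2m`: the product `S^m(a / (k l)) × S^m(a / l)` with `k = m / (m - 1)` and
    -- `l = 3 m (m - 1) / 2`
    (∀ m : ℕ, 2 ≤ m → ∀ a : ℝ, 0 < a →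
      ∃ g : StaticSpace.RMetric ((𝓡 m).prod (𝓡 m)) (StaticSpace.Sph m × StaticSpace.Sph m),
        StaticSpace.IsRoundProduct
          (a / (((m : ℝ) / ((m : ℝ) - 1)) * (3 * (m : ℝ) * ((m : ℝ) - 1) / 2)))
          (a / (3 * (m : ℝ) * ((m : ℝ) - 1) / 2)) g ∧
        StaticSpace.IsExample g) ∧
    -- dimension `2m + 1`: the product `S^m × S^(m+1)` of unit spheres
    (∀ m : ℕ, 2 ≤ m →
      ∃ g : StaticSpace.RMetric ((𝓡 m).prod (𝓡 (m + 1)))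
          (StaticSpace.Sph m × StaticSpace.Sph (m + 1)),
        StaticSpace.IsRoundProduct 1 1 g ∧ StaticSpace.IsExample g) := by
  -- For $p=q=m$ the static relation is $c_2/c_1=m/(m-1)=k$; `a` and $l$ only rescale the metric.
  have even : ∀ m : ℕ, 2 ≤ m → ∀ a : ℝ, 0 < a →
      0 < a / (((m : ℝ) / ((m : ℝ) - 1)) * (3 * (m : ℝ) * ((m : ℝ) - 1) / 2)) ∧
      0 < a / (3 * (m : ℝ) * ((m : ℝ) - 1) / 2) ∧
      ((m : ℝ) - 1) * (a / (3 * (m : ℝ) * ((m : ℝ) - 1) / 2))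
        = m * (a / (((m : ℝ) / ((m : ℝ) - 1)) * (3 * (m : ℝ) * ((m : ℝ) - 1) / 2))) := by
    intro m hm a ha
    have hm' : (2 : ℝ) ≤ m := by exact_mod_cast hm
    have h0 : (0 : ℝ) < m := by linarith
    have h1 : (0 : ℝ) < (m : ℝ) - 1 := by linarith
    refine ⟨by positivity, by positivity, ?_⟩
    field_simp
  -- For $q=p+1$ the static relation becomes $c_1=c_2$, so unit spheres suffice.
  have odd : ∀ m : ℕ, (((m + 1 : ℕ) : ℝ) - 1) * 1 = m * 1 := fun m => by push_cast; ring
  refine ⟨fun n hn => ?_, fun m hm a ha => ?_, fun m hm => ?_⟩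
  · obtain ⟨m, rfl | rfl⟩ := Nat.even_or_odd' n
    · obtain ⟨h₁, h₂, hc⟩ := even m (by omega) 1 one_pos
      have h := StaticSpace.exists_example_of_finrank_add (p := m) (q := m) (by omega) (by omega)
        h₁ h₂ hc
      rwa [← two_mul] at h
    · have h := StaticSpace.exists_example_of_finrank_add (p := m) (q := m + 1) (by omega)
        (by omega) one_pos one_pos (odd m)
      rwa [← add_assoc, ← two_mul] at h
  · obtain ⟨h₁, h₂, hc⟩ := even m hm a ha
    exact StaticSpace.exists_isExample_roundProduct hm hm h₁ h₂ hc
  · exact StaticSpace.exists_isExample_roundProduct hm (by omega) one_pos one_pos (odd m)
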